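/- \textbf{Setting.} The terms are $t,u ::= s \mid x \mid f \mid [x{:}t]u \mid t\,u \mid (x{:}t)u$ with $s\in\{\star,\Box\}$, $x$ a variable and $f\in\mathcal F$ a symbol, taken modulo renaming of bound variables; they need not be typable. Every symbol $f$ has a sort $s_f$, an arity $\alpha_f$ and a closed type $\tau_f=(\vec x{:}\vec T)U$ with $|\vec x|=\alpha_f$; $f$ is a \emph{predicate symbol} if $s_f=\Box$ and a \emph{function symbol} if $s_f=\star$. \emph{Algebraic} terms are those built from variables and applications $f\vec t$ with $|\vec t|=\alpha_f$. A \emph{rule} is a pair $l\to r$ of terms with $l$ algebraic, not a variable, and $\mathrm{FV}(r)\subseteq\mathrm{FV}(l)$. Let $\mathcal R$ be a set of rules and $\mathcal E$ a symmetric set of rules (equations), $\to_\beta,\to_{\mathcal R},\to_{\mathcal E}$ the corresponding one-step relations (at any position of a term), $\sim$ the reflexive and transitive closure of $\to_{\mathcal E}$, and $\rhd\ =\ \to_\beta\cup\sim\to_{\mathcal R}$. Let $\mathcal{SN}$ be the set of strongly normalizing terms for $\rhd$. A symbol is \emph{constant} if no rule of $\mathcal R$ is headed by it. A constant predicate symbol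 $C$ of type $(\vec x{:}\vec T)\star$ is \emph{primitive} if it is not polymorphic (no $T_i$ is of the form $(\vec z{:}\vec V)\star$) and its constructors (the constant function symbols of type $(\vec y{:}\vec U)C\vec v$) have no functional arguments (no $U_j$ is a product). A symbol $f$ is \emph{first-order} if it is a predicate symbol of type $(\vec x{:}\vec T)\star$ with $|\vec x|=\alpha_f$, or a function symbol of type $(\vec x{:}\vec T)C\vec v$ with $|\vec x|=\alpha_f$ and $C$ primitive. Let $\mathcal F_1$ be a set of first-order symbols, $\mathcal F_\omega=\mathcal F\setminus\mathcal F_1$, and let $\mathcal R_\iota,\mathcal E_\iota$ ($\iota\in\{1,\omega\}$) be the sets of rules of $\mathcal R$, $\mathcal E$ whose left-hand side is headed by a symbol of $\mathcal F_\iota$. Let $\sim_1$ be the reflexive and transitive closure of $\to_{\mathcal E_1}$. A \emph{first-order algebraic} term is an algebraic term whose symbols are all in $\mathcal F_1$. A rule is \emph{non-duplicating} if no variable occurs more often in its right-hand side than in its left-hand side. Assume that: \begin{itemize} \item both sides of every rule of $\mathcal R_1\cup\mathcal E_1$ are first-order algebraic, and $\sim_1\to_{\mathcal R_1}$ is strongly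 normalizing on first-order algebraic terms; \item if $\mathcal R_\omega\neq\emptyset$, then the rules of $\mathcal R_1$ are non-duplicating; \item $\mathcal E$ is linear (no variable occurs twice in a side of an equation), and all $\sim$-equivalence classes are finite. \end{itemize} \textbf{Theorem (Computability of first-order symbols).} Let $f\in\mathcal F_1$ and let $\vec t$ be a sequence of at most $\alpha_f$ terms of $\mathcal{SN}$. If some rule of $\mathcal R_1$ is duplicating, assume also that no term to which some $t_i$ reduces by $\to_\beta\cup\to_{\mathcal R}\cup\to_{\mathcal E}$ (in any number of steps, possibly zero) contains an over-applied first-order symbol, i.e. a subterm $(g\vec u)\,v$ with $g\in\mathcal F_1$ and $|\vec u|=\alpha_g$. Then $f\vec t\in\mathcal{SN}$. -/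

import Mathlib

/-! Terms of the Calculus of Algebraic Constructions, in de Bruijn notation: variables are natural
numbers, so that equality of terms is equality modulo renaming of bound variables. -/

namespace CAC

/-- The two sorts: `star` is the universe of types, `box` the universe of kinds. -/
inductive Srt where
  | star
  | box

/-- Terms over a set `F` of symbols: sorts, variables, symbols, abstractions `[x:A]t`,
applications `t u` and dependent products `(x:A)B`. The index `0` is bound in the second
argument of `lam` and `prod`. -/
inductive Term (F : Type*) where
  | sort (s : Srt)
  | var (n : ℕ)
  | sym (f : F)
  | lam (A t : Term F)
  | app (t u : Term F)
  | prod (A B : Term F)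

variable {F : Type*}

namespace Term

/-- Renaming of free variables. -/
def rename : (ℕ → ℕ) → Term F → Term F
  | _, sort s => sort s
  | ρ, var n => var (ρ n)
  | _, sym f => sym f
  | ρ, lam A t => lam (rename ρ A) (rename (fun n => n.casesOn 0 (fun k => ρ k + 1)) t)
  | ρ, app t u => app (rename ρ t) (rename ρ u)
  | ρ, prod A B => prod (rename ρ A) (rename (fun n => n.casesOn 0 (fun k => ρ k + 1)) B)

/-- The substitution used below a binder: it keeps the bound variable and avoids capture. -/
def lift (σ : ℕ → Term F) : ℕ → Term F
  | 0 => var 0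
  | n + 1 => rename Nat.succ (σ n)

/-- Capture-avoiding simultaneous substitution `tσ`. -/
def subst : (ℕ → Term F) → Term F → Term F
  | _, sort s => sort s
  | σ, var n => σ n
  | _, sym f => sym f
  | σ, lam A t => lam (subst σ A) (subst (lift σ) t)
  | σ, app t u => app (subst σ t) (subst σ u)
  | σ, prod A B => prod (subst σ A) (subst (lift σ) B)

/-- `t{x → u}` where `x` is the variable bound by the abstraction with body `t`. -/
def inst (t u : Term F) : Term F :=
  subst (fun n => n.casesOn u var) t

/-- The number of free occurrences of the variable `x` in a term. -/
def occ : ℕ → Term F → ℕ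
  | _, sort _ => 0
  | x, var n => if n = x then 1 else 0
  | _, sym _ => 0
  | x, lam A t => occ x A + occ (x + 1) t
  | x, app t u => occ x t + occ x u
  | x, prod A B => occ x A + occ (x + 1) B

/-- The free variables of a term. -/
def FV (t : Term F) : Set ℕ := {x | occ x t ≠ 0}

/-- The iterated application `t u₁ … uₙ`. -/
def apps (t : Term F) (us : List (Term F)) : Term F := us.foldl app t

/-- The iterated product `(x₁:T₁) … (xₙ:Tₙ) U`. -/
def prods (Ts : List (Term F)) (U : Term F) : Term F := Ts.foldr prod U

/-- A term is linear if no variable occurs more than once in it. -/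
def Linear (t : Term F) : Prop := ∀ x, occ x t ≤ 1

end Term

open Term

/-- Every symbol has a sort, an arity and a type, which is a closed term of the form
`(x₁:T₁) … (xₙ:Tₙ) U` where `n` is the arity. -/
structure Signature (F : Type*) where
  symSort : F → Srt
  arity : F → ℕ
  typ : F → Term F
  typ_closed : ∀ f, FV (typ f) = ∅
  typ_form : ∀ f, ∃ Ts U, Ts.length = arity f ∧ typ f = prods Ts U

/-- The algebraic terms whose symbols all belong to `G`: they are built from variables and
applications `f t₁ … tₙ` where `f ∈ G` and `n` is the arity of `f`. -/
inductive AlgebraicIn (S : Signature F) (G : Set F) : Term F → Prop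
  | var (n : ℕ) : AlgebraicIn S G (Term.var n)
  | app (f : F) (ts : List (Term F)) : f ∈ G → ts.length = S.arity f →
      (∀ t ∈ ts, AlgebraicIn S G t) → AlgebraicIn S G (apps (sym f) ts)

/-- A pair `l → r` of terms. -/
structure Rule (F : Type*) where
  lhs : Term F
  rhs : Term F

/-- The three conditions that make a pair of terms a rewrite rule. -/
structure IsRule (S : Signature F) (ρ : Rule F) : Prop where
  algebraic : AlgebraicIn S Set.univ ρ.lhs
  not_var : ∀ n, ρ.lhs ≠ var n
  fv_subset : FV ρ.rhs ⊆ FV ρ.lhs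

/-- No variable occurs more in the right-hand side than in the left-hand side. -/
def NonDuplicating (ρ : Rule F) : Prop := ∀ x, occ x ρ.rhs ≤ occ x ρ.lhs

/-- The rules of `R` whose left-hand side is headed by a symbol of `G`. -/
def headedBy (R : Set (Rule F)) (G : Set F) : Set (Rule F) :=
  {ρ | ρ ∈ R ∧ ∃ f ∈ G, ∃ ts, ρ.lhs = apps (sym f) ts}

/-- Application of a relation at an arbitrary position of a term. -/
inductive Ctx (r : Term F → Term F → Prop) : Term F → Term F → Prop
  | root {t t'} : r t t' → Ctx r t t'
  | lamL {A A'} (t) : Ctx r A A' → Ctx r (lam A t) (lam A' t)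
  | lamR (A) {t t'} : Ctx r t t' → Ctx r (lam A t) (lam A t')
  | appL {t t'} (u) : Ctx r t t' → Ctx r (app t u) (app t' u)
  | appR (t) {u u'} : Ctx r u u' → Ctx r (app t u) (app t u')
  | prodL {A A'} (B) : Ctx r A A' → Ctx r (prod A B) (prod A' B)
  | prodR (A) {B B'} : Ctx r B B' → Ctx r (prod A B) (prod A B')

/-- The relation `→_β`. -/
def Beta : Term F → Term F → Prop :=
  Ctx fun a b => ∃ A t u, a = app (lam A t) u ∧ b = inst t u

/-- The relation `→_R`. -/
def Rew (R : Set (Rule F)) : Term F → Term F → Prop :=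
  Ctx fun a b => ∃ ρ ∈ R, ∃ σ, a = subst σ ρ.lhs ∧ b = subst σ ρ.rhs

/-- The reflexive and transitive closure `∼` of `→_E`. -/
def Equ (E : Set (Rule F)) : Term F → Term F → Prop := Relation.ReflTransGen (Rew E)

/-- Rewriting modulo equations: `t ∼ u →_R t'` for some `u`. -/
def RewMod (E R : Set (Rule F)) (t t' : Term F) : Prop := ∃ u, Equ E t u ∧ Rew R u t'

/-- The union of `→_β` and of rewriting with `R` modulo `E`. -/
def Step (E R : Set (Rule F)) (t t' : Term F) : Prop := Beta t t' ∨ RewMod E R t t'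

/-- The reflexive and transitive closure of `→_β ∪ →_R ∪ →_E`. -/
def Reduces (E R : Set (Rule F)) : Term F → Term F → Prop :=
  Relation.ReflTransGen fun t t' => Beta t t' ∨ Rew R t t' ∨ Rew E t t'

/-- A term is strongly normalizing for a relation if no infinite reduction starts from it. -/
def SN (r : Term F → Term F → Prop) (t : Term F) : Prop := Acc (fun b a => r a b) t

/-- A symbol is constant if no rule is headed by it. -/
def IsConstant (R : Set (Rule F)) (f : F) : Prop := headedBy R {f} = ∅

/-- `c` is a constructor of `C`: a constant function symbol of type `(y₁:U₁) … (yₙ:Uₙ) C v₁ … vₖ`,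
where `Us` is the list of the types of its arguments. -/
def IsConstructor (S : Signature F) (R : Set (Rule F)) (C c : F) (Us : List (Term F)) : Prop :=
  S.symSort c = Srt.star ∧ IsConstant R c ∧ ∃ vs, S.typ c = prods Us (apps (sym C) vs)

/-- A primitive predicate symbol is a constant predicate symbol that is not polymorphic (none of
its arguments ranges over a kind `(z₁:V₁) … (zₘ:Vₘ) ⋆`) and whose constructors have no functional
argument (none of their arguments has a product type). -/
def IsPrimitive (S : Signature F) (R : Set (Rule F)) (C : F) : Prop :=
  S.symSort C = Srt.box ∧ IsConstant R C ∧
  (∃ Ts, S.typ C = prods Ts (sort Srt.star) ∧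
    ∀ T ∈ Ts, ¬ ∃ Vs, T = prods Vs (sort Srt.star)) ∧
  ∀ c Us, IsConstructor S R C c Us → ∀ U ∈ Us, ¬ ∃ A B, U = prod A B

/-- A symbol can be taken as first-order if it is a predicate symbol of maximal arity, or a
function symbol whose output type is headed by a primitive predicate symbol. -/
def IsFirstOrder (S : Signature F) (R : Set (Rule F)) (f : F) : Prop :=
  (S.symSort f = Srt.box ∧
    ∃ Ts, Ts.length = S.arity f ∧ S.typ f = prods Ts (sort Srt.star)) ∨
  (S.symSort f = Srt.star ∧
    ∃ Ts C vs, Ts.length = S.arity f ∧ S.typ f = prods Ts (apps (sym C) vs) ∧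
      IsPrimitive S R C)

/-- In no subterm is `g u₁ … uₙ`, with `g ∈ G` and `n` the arity of `g`, applied to a further
argument. -/
def NotOverApplied (S : Signature F) (G : Set F) : Term F → Prop
  | sort _ => True
  | var _ => True
  | sym _ => True
  | lam A t => NotOverApplied S G A ∧ NotOverApplied S G t
  | app t u => (¬ ∃ g ∈ G, ∃ us, us.length = S.arity g ∧ t = apps (sym g) us) ∧
      NotOverApplied S G t ∧ NotOverApplied S G u
  | prod A B => NotOverApplied S G A ∧ NotOverApplied S G B

end CAC

/-! Call alien a maximal subterm that is not headed by a fully applied symbol of `F₁`, and cap the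
first-order algebraic part above the aliens. When `f` has all its arguments, the aliens of the term
are subterms of the arguments, hence strongly normalizing. A rewriting or equational step occurs
either in an alien or in the cap, a `β`-step only in an alien (`Ctx.decompose`). In the second case
it is a first-order step on caps, whatever algebraic terms replace the aliens
(`AlgebraicIn.cap_aliens`), and first-order rewriting terminates by hypothesis. The two measures,
the aliens and the cap, remain to be combined.

Equations are linear and symmetric, so they exchange with `β` one step for one step
(`rew_beta_commute`). Hence strong normalization is invariant under equivalence, and being a subterm
of a reduct is a well-founded relation on classes of strongly normalizing terms
(`wellFounded_clsLT`). Aliens are compared by the multiset extension of this relation.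

If the first-order rules are non-duplicating, a cap step adds no alien, while a step in an alien may
enlarge the cap: the order is lexicographic, aliens first, then the cap with a single variable for
all aliens, so that non-linear left-hand sides still match (`sn_of_nonDuplicating`).

If some first-order rule is duplicating, every rule is first-order and the cap has to come first.
Each alien is then replaced by the cap of its `β`-normal form: a `β`-step in an alien leaves this
unchanged, and a rewrite step in an alien becomes a rewriting of its normal form
(`exists_betaNormal_rew`). The latter holds because, without over-application, rewriting a
`β`-normal term creates no `β`-redex and never turns an alien into a term headed by a first-order
symbol (`sn_of_neverOverApplied`).

With missing arguments no rule applies at the head, and only the arguments reduce (`sn_partial`). -/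

namespace CAC

open Term Relation

variable {F : Type*}

/-! ### Calculus of renamings and substitutions -/

namespace Term

/-- The renaming used below a binder. -/
def liftRen (ρ : ℕ → ℕ) : ℕ → ℕ := fun n => n.casesOn 0 (fun k => ρ k + 1)

theorem rename_rename (t : Term F) : ∀ ρ ρ' : ℕ → ℕ,
    rename ρ' (rename ρ t) = rename (fun n => ρ' (ρ n)) t := by
  have key : ∀ ρ ρ' : ℕ → ℕ, (fun n => liftRen ρ' (liftRen ρ n)) = liftRen fun n => ρ' (ρ n) := by
    intro ρ ρ'; funext n; cases n <;> rfl
  induction t with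
  | sort s => intros; rfl
  | var n => intros; rfl
  | sym f => intros; rfl
  | lam A t ihA iht =>
    intro ρ ρ'
    change lam _ (rename (liftRen ρ') (rename (liftRen ρ) t)) = lam _ (rename (liftRen _) t)
    rw [ihA, iht, key]
  | app t u iht ihu => intro ρ ρ'; simp only [rename, iht, ihu]
  | prod A t ihA iht =>
    intro ρ ρ'
    change prod _ (rename (liftRen ρ') (rename (liftRen ρ) t)) = prod _ (rename (liftRen _) t)
    rw [ihA, iht, key]

theorem subst_rename (t : Term F) : ∀ (ρ : ℕ → ℕ) (σ : ℕ → Term F),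
    subst σ (rename ρ t) = subst (fun n => σ (ρ n)) t := by
  have key : ∀ (ρ : ℕ → ℕ) (σ : ℕ → Term F),
      (fun n => lift σ (liftRen ρ n)) = lift fun n => σ (ρ n) := by
    intro ρ σ; funext n; cases n <;> rfl
  induction t with
  | sort s => intros; rfl
  | var n => intros; rfl
  | sym f => intros; rfl
  | lam A t ihA iht =>
    intro ρ σ
    change lam _ (subst (lift σ) (rename (liftRen ρ) t)) = lam _ _
    rw [ihA, iht, key]
  | app t u iht ihu => intro ρ σ; simp only [rename, subst, iht, ihu]
  | prod A t ihA iht =>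
    intro ρ σ
    change prod _ (subst (lift σ) (rename (liftRen ρ) t)) = prod _ _
    rw [ihA, iht, key]

theorem rename_subst (t : Term F) : ∀ (ρ : ℕ → ℕ) (σ : ℕ → Term F),
    rename ρ (subst σ t) = subst (fun n => rename ρ (σ n)) t := by
  have key : ∀ (ρ : ℕ → ℕ) (σ : ℕ → Term F),
      (fun n => rename (liftRen ρ) (lift σ n)) = lift fun n => rename ρ (σ n) := by
    intro ρ σ; funext n
    cases n with
    | zero => rfl
    | succ n =>
      change rename (liftRen ρ) (rename Nat.succ (σ n)) = rename Nat.succ (rename ρ (σ n))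
      rw [rename_rename, rename_rename]; rfl
  induction t with
  | sort s => intros; rfl
  | var n => intros; rfl
  | sym f => intros; rfl
  | lam A t ihA iht =>
    intro ρ σ
    change lam _ (rename (liftRen ρ) (subst (lift σ) t)) = lam _ _
    rw [ihA, iht, key]
  | app t u iht ihu => intro ρ σ; simp only [rename, subst, iht, ihu]
  | prod A t ihA iht =>
    intro ρ σ
    change prod _ (rename (liftRen ρ) (subst (lift σ) t)) = prod _ _
    rw [ihA, iht, key]

theorem subst_subst (t : Term F) : ∀ σ τ : ℕ → Term F,
    subst τ (subst σ t) = subst (fun n => subst τ (σ n)) t := by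
  have key : ∀ σ τ : ℕ → Term F,
      (fun n => subst (lift τ) (lift σ n)) = lift fun n => subst τ (σ n) := by
    intro σ τ; funext n
    cases n with
    | zero => rfl
    | succ n =>
      change subst (lift τ) (rename Nat.succ (σ n)) = rename Nat.succ (subst τ (σ n))
      rw [subst_rename, rename_subst]; rfl
  induction t with
  | sort s => intros; rfl
  | var n => intros; rfl
  | sym f => intros; rfl
  | lam A t ihA iht => intro σ τ; simp only [subst, ihA, iht, key]
  | app t u iht ihu => intro σ τ; simp only [subst, iht, ihu]
  | prod A t ihA iht => intro σ τ; simp only [subst, ihA, iht, key]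

theorem lift_var : lift (var : ℕ → Term F) = var := by
  funext n; cases n <;> rfl

theorem subst_var (t : Term F) : subst var t = t := by
  induction t with
  | sort s => rfl
  | var n => rfl
  | sym f => rfl
  | lam A t ihA iht => simp only [subst, lift_var, ihA, iht]
  | app t u iht ihu => simp only [subst, iht, ihu]
  | prod A t ihA iht => simp only [subst, lift_var, ihA, iht]

theorem rename_eq_subst (ρ : ℕ → ℕ) (t : Term F) : rename ρ t = subst (fun n => var (ρ n)) t := by
  have := rename_subst t ρ var
  rwa [subst_var] at this

theorem subst_inst (σ : ℕ → Term F) (t u : Term F) :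
    subst σ (inst t u) = inst (subst (lift σ) t) (subst σ u) := by
  unfold inst
  rw [subst_subst, subst_subst]
  congr 1; funext n
  cases n with
  | zero => rfl
  | succ n =>
    change σ n = subst _ (rename Nat.succ (σ n))
    rw [subst_rename]
    exact (subst_var _).symm

theorem apps_concat (t : Term F) (us : List (Term F)) (u : Term F) :
    apps t (us ++ [u]) = app (apps t us) u := by
  simp [apps]

end Term

/-! ### Relations closed under contexts -/

/-- A relation compatible with all term constructors. -/
structure CtxClosed (J : Term F → Term F → Prop) : Prop where
  lamL : ∀ {A A'} (t), J A A' → J (lam A t) (lam A' t)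
  lamR : ∀ (A) {t t'}, J t t' → J (lam A t) (lam A t')
  appL : ∀ {t t'} (u), J t t' → J (app t u) (app t' u)
  appR : ∀ (t) {u u'}, J u u' → J (app t u) (app t u')
  prodL : ∀ {A A'} (B), J A A' → J (prod A B) (prod A' B)
  prodR : ∀ (A) {B B'}, J B B' → J (prod A B) (prod A B')

theorem Ctx.closed (r : Term F → Term F → Prop) : CtxClosed (Ctx r) :=
  ⟨Ctx.lamL, Ctx.lamR, Ctx.appL, Ctx.appR, Ctx.prodL, Ctx.prodR⟩

theorem star_map {J K : Term F → Term F → Prop} {g : Term F → Term F}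
    (h : ∀ a b, J a b → K (g a) (g b)) {a b : Term F} (hab : ReflTransGen J a b) :
    ReflTransGen K (g a) (g b) := by
  induction hab with
  | refl => exact .refl
  | tail _ h' ih => exact ih.tail (h _ _ h')

theorem CtxClosed.star {J : Term F → Term F → Prop} (h : CtxClosed J) :
    CtxClosed (ReflTransGen J) where
  lamL t h' := star_map (g := fun A => lam A t) (fun _ _ => h.lamL t) h'
  lamR A _ _ := star_map (g := lam A) fun _ _ => h.lamR A
  appL u h' := star_map (g := fun t => app t u) (fun _ _ => h.appL u) h'
  appR t _ _ := star_map (g := app t) fun _ _ => h.appR t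
  prodL B h' := star_map (g := fun A => prod A B) (fun _ _ => h.prodL B) h'
  prodR A _ _ := star_map (g := prod A) fun _ _ => h.prodR A

theorem CtxClosed.comp {J K : Term F → Term F → Prop} (hJ : CtxClosed J) (hK : CtxClosed K) :
    CtxClosed fun a c => ∃ b, J a b ∧ K b c where
  lamL t := fun ⟨_, h, k⟩ => ⟨_, hJ.lamL t h, hK.lamL t k⟩
  lamR t _ _ := fun ⟨_, h, k⟩ => ⟨_, hJ.lamR t h, hK.lamR t k⟩
  appL t := fun ⟨_, h, k⟩ => ⟨_, hJ.appL t h, hK.appL t k⟩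
  appR t _ _ := fun ⟨_, h, k⟩ => ⟨_, hJ.appR t h, hK.appR t k⟩
  prodL t := fun ⟨_, h, k⟩ => ⟨_, hJ.prodL t h, hK.prodL t k⟩
  prodR t _ _ := fun ⟨_, h, k⟩ => ⟨_, hJ.prodR t h, hK.prodR t k⟩

theorem CtxClosed.swap {J : Term F → Term F → Prop} (hJ : CtxClosed J) :
    CtxClosed fun a b => J b a where
  lamL t := hJ.lamL t
  lamR t _ _ := hJ.lamR t
  appL t := hJ.appL t
  appR t _ _ := hJ.appR t
  prodL t := hJ.prodL t
  prodR t _ _ := hJ.prodR t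

theorem Ctx.le_of_closed {r J : Term F → Term F → Prop} (hJ : CtxClosed J)
    (h : ∀ a b, r a b → J a b) {t t'} (ht : Ctx r t t') : J t t' := by
  induction ht with
  | root hr => exact h _ _ hr
  | lamL t _ ih => exact hJ.lamL t ih
  | lamR t _ ih => exact hJ.lamR t ih
  | appL t _ ih => exact hJ.appL t ih
  | appR t _ ih => exact hJ.appR t ih
  | prodL t _ ih => exact hJ.prodL t ih
  | prodR t _ ih => exact hJ.prodR t ih

theorem Ctx.mono {r s : Term F → Term F → Prop} (h : ∀ a b, r a b → s a b) {t t'}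
    (ht : Ctx r t t') : Ctx s t t' :=
  Ctx.le_of_closed (Ctx.closed s) (fun _ _ hr => .root (h _ _ hr)) ht

/-- A relation on terms stable under substitution. -/
def SubstStable (r : Term F → Term F → Prop) : Prop :=
  ∀ σ a b, r a b → r (subst σ a) (subst σ b)

theorem SubstStable.ctx {r : Term F → Term F → Prop} (h : SubstStable r) :
    SubstStable (Ctx r) := by
  intro σ a b hab
  induction hab generalizing σ with
  | root hr => exact .root (h _ _ _ hr)
  | lamL t _ ih => exact .lamL _ (ih _)
  | lamR t _ ih => exact .lamR _ (ih _)
  | appL t _ ih => exact .appL _ (ih _)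
  | appR t _ ih => exact .appR _ (ih _)
  | prodL t _ ih => exact .prodL _ (ih _)
  | prodR t _ ih => exact .prodR _ (ih _)

theorem SubstStable.star {r : Term F → Term F → Prop} (h : SubstStable r) :
    SubstStable (ReflTransGen r) :=
  fun σ _ _ => star_map (g := subst σ) (h σ)

/-- Contraction of a `β`-redex at the root. -/
def BetaRoot (a b : Term F) : Prop := ∃ A t u, a = app (lam A t) u ∧ b = inst t u

/-- Application of a rule at the root. -/
def RewRoot (X : Set (Rule F)) (a b : Term F) : Prop :=
  ∃ ρ ∈ X, ∃ σ, a = subst σ ρ.lhs ∧ b = subst σ ρ.rhs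

theorem betaRoot_stable : SubstStable (BetaRoot (F := F)) := by
  rintro σ _ _ ⟨A, t, u, rfl, rfl⟩
  exact ⟨_, _, _, rfl, subst_inst _ _ _⟩

theorem rewRoot_stable (X : Set (Rule F)) : SubstStable (RewRoot X) := by
  rintro σ _ _ ⟨ρ, hρ, τ, rfl, rfl⟩
  exact ⟨ρ, hρ, _, subst_subst _ _ _, subst_subst _ _ _⟩

theorem beta_closed : CtxClosed (Beta (F := F)) := Ctx.closed _
theorem rew_closed (X : Set (Rule F)) : CtxClosed (Rew X) := Ctx.closed _
theorem beta_stable : SubstStable (Beta (F := F)) := betaRoot_stable.ctx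

theorem Rew.mono {X Y : Set (Rule F)} (h : X ⊆ Y) {t t' : Term F} (ht : Rew X t t') :
    Rew Y t t' :=
  Ctx.mono (fun _ _ ⟨ρ, hρ, σ⟩ => ⟨ρ, h hρ, σ⟩) ht

theorem subst_star {J : Term F → Term F → Prop} (hc : CtxClosed J) (hs : SubstStable J)
    (t : Term F) : ∀ {σ τ : ℕ → Term F}, (∀ n, ReflTransGen J (σ n) (τ n)) →
      ReflTransGen J (subst σ t) (subst τ t) := by
  have key : ∀ {σ τ : ℕ → Term F}, (∀ n, ReflTransGen J (σ n) (τ n)) →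
      ∀ n, ReflTransGen J (lift σ n) (lift τ n) := by
    intro σ τ h n
    cases n with
    | zero => exact .refl
    | succ n =>
      change ReflTransGen J (rename Nat.succ (σ n)) (rename Nat.succ (τ n))
      rw [rename_eq_subst, rename_eq_subst]
      exact hs.star _ _ _ (h n)
  induction t with
  | sort s => intros; exact .refl
  | var n => intro σ τ h; exact h n
  | sym f => intros; exact .refl
  | lam A t ihA iht =>
    intro σ τ h
    exact (hc.star.lamL _ (ihA h)).trans (hc.star.lamR _ (iht (key h)))
  | app t u iht ihu =>
    intro σ τ h
    exact (hc.star.appL _ (iht h)).trans (hc.star.appR _ (ihu h))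
  | prod A t ihA iht =>
    intro σ τ h
    exact (hc.star.prodL _ (ihA h)).trans (hc.star.prodR _ (iht (key h)))

theorem inst_left {J : Term F → Term F → Prop} (hs : SubstStable J) {t t' : Term F} (u : Term F)
    (h : J t t') : J (inst t u) (inst t' u) := hs _ _ _ h

theorem inst_right {J : Term F → Term F → Prop} (hc : CtxClosed J) (hs : SubstStable J)
    (t : Term F) {u u' : Term F} (h : J u u') : ReflTransGen J (inst t u) (inst t u') := by
  refine subst_star hc hs t fun n => ?_
  cases n with
  | zero => exact .single h
  | succ n => exact .refl

/-- A reduction inside a `β`-redex can be performed after its contraction. -/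
theorem betaRoot_commute {r : Term F → Term F → Prop} (hr : SubstStable r)
    (hlam : ∀ A t b, ¬ r (lam A t) b) {a b a' : Term F} (hb : BetaRoot a b) (hx : Ctx r a a') :
    r a a' ∨ ∃ b', BetaRoot a' b' ∧ ReflTransGen (Ctx r) b b' := by
  obtain ⟨A, t, u, rfl, rfl⟩ := hb
  cases hx with
  | root h => exact .inl h
  | appL _ h =>
    right
    cases h with
    | root h => exact (hlam _ _ _ h).elim
    | lamL _ h => exact ⟨_, ⟨_, _, _, rfl, rfl⟩, .refl⟩
    | lamR _ h => exact ⟨_, ⟨_, _, _, rfl, rfl⟩, .single (inst_left hr.ctx _ h)⟩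
  | appR _ h => exact .inr ⟨_, ⟨_, _, _, rfl, rfl⟩, inst_right (Ctx.closed r) hr.ctx _ h⟩

/-- Local commutation of `β` with the contextual closure of `r`, up to a relation `J`: only the
case where `r` is applied at the root has to be checked. -/
theorem beta_commute {r J : Term F → Term F → Prop} (hr : SubstStable r)
    (hlam : ∀ A t b, ¬ r (lam A t) b) (hJ : CtxClosed J)
    (hsq : ∀ {v u w}, ReflTransGen (Ctx r) v w → Beta u w → J v u)
    (hroot : ∀ {a b v}, r a b → Beta a v → J v b) {t u v : Term F}
    (hx : Ctx r t u) (hb : Beta t v) : J v u := by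
  induction hx generalizing v with
  | root h => exact hroot h hb
  | lamL t h ih =>
    cases hb with
    | root hb => obtain ⟨_, _, _, h, _⟩ := hb; cases h
    | lamL _ hb => exact hJ.lamL _ (ih hb)
    | lamR _ hb => exact hsq (.single (.lamL _ h)) (.lamR _ hb)
  | lamR t h ih =>
    cases hb with
    | root hb => obtain ⟨_, _, _, h, _⟩ := hb; cases h
    | lamR _ hb => exact hJ.lamR _ (ih hb)
    | lamL _ hb => exact hsq (.single (.lamR _ h)) (.lamL _ hb)
  | prodL t h ih =>
    cases hb with
    | root hb => obtain ⟨_, _, _, h, _⟩ := hb; cases h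
    | prodL _ hb => exact hJ.prodL _ (ih hb)
    | prodR _ hb => exact hsq (.single (.prodL _ h)) (.prodR _ hb)
  | prodR t h ih =>
    cases hb with
    | root hb => obtain ⟨_, _, _, h, _⟩ := hb; cases h
    | prodR _ hb => exact hJ.prodR _ (ih hb)
    | prodL _ hb => exact hsq (.single (.prodR _ h)) (.prodL _ hb)
  | appL t h ih =>
    cases hb with
    | root hb' =>
      rcases betaRoot_commute hr hlam hb' (.appL t h) with h' | ⟨b', h1, h2⟩
      · exact hroot h' (.root hb')
      · exact hsq h2 (.root h1)
    | appL _ hb => exact hJ.appL _ (ih hb)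
    | appR _ hb => exact hsq (.single (.appL _ h)) (.appR _ hb)
  | appR t h ih =>
    cases hb with
    | root hb' =>
      rcases betaRoot_commute hr hlam hb' (.appR t h) with h' | ⟨b', h1, h2⟩
      · exact hroot h' (.root hb')
      · exact hsq h2 (.root h1)
    | appR _ hb => exact hJ.appR _ (ih hb)
    | appL _ hb => exact hsq (.single (.appR _ h)) (.appL _ hb)

/-! ### Confluence of `β` on strongly normalizing terms -/

theorem beta_closed_join : CtxClosed fun a b : Term F =>
    ∃ c, ReflTransGen Beta a c ∧ ReflTransGen Beta b c :=
  beta_closed.star.comp beta_closed.star.swap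

theorem beta_locally_confluent {t u v : Term F} (hu : Beta t u) (hv : Beta t v) :
    ∃ w, ReflTransGen Beta v w ∧ ReflTransGen Beta u w := by
  have hlam : ∀ A t b, ¬ BetaRoot (F := F) (lam A t) b := by rintro _ _ _ ⟨_, _, _, h, _⟩; cases h
  refine beta_commute (r := BetaRoot) (J := fun a b => ∃ c, ReflTransGen Beta a c ∧
    ReflTransGen Beta b c) betaRoot_stable hlam beta_closed_join
    (fun h1 h2 => ⟨_, h1, .single h2⟩) ?_ hu hv
  intro a b v h hb
  rcases betaRoot_commute betaRoot_stable hlam h hb with h' | ⟨b', h1, h2⟩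
  · obtain ⟨_, _, _, rfl, rfl⟩ := h
    obtain ⟨_, _, _, h, rfl⟩ := h'
    cases h
    exact ⟨_, .refl, .refl⟩
  · exact ⟨b', .single (.root h1), h2⟩

/-- A term without `β`-redex. -/
def BetaNormal (t : Term F) : Prop := ∀ u, ¬ Beta t u

theorem BetaNormal.eq {t u : Term F} (h : BetaNormal t) (hu : ReflTransGen Beta t u) : u = t := by
  rcases ReflTransGen.cases_head hu with rfl | ⟨_, h1, _⟩
  · rfl
  · exact (h _ h1).elim

theorem exists_betaNormal {t : Term F} (h : SN Beta t) :
    ∃ n, ReflTransGen Beta t n ∧ BetaNormal n := by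
  induction h with
  | intro t _ ih =>
    by_cases ht : BetaNormal t
    · exact ⟨t, .refl, ht⟩
    · obtain ⟨u, hu⟩ : ∃ u, Beta t u := by simpa [BetaNormal] using ht
      obtain ⟨n, h1, h2⟩ := ih u hu
      exact ⟨n, .head hu h1, h2⟩

/-- The reducts of a strongly `β`-normalizing term reduce to each of its normal forms. -/
theorem beta_confluent {t n u : Term F} (h : SN Beta t) (hn : ReflTransGen Beta t n)
    (hn' : BetaNormal n) (hu : ReflTransGen Beta t u) : ReflTransGen Beta u n := by
  induction h generalizing n u with
  | intro t ht ih =>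
    rcases ReflTransGen.cases_head hu with rfl | ⟨u₁, hu₁, hu₂⟩
    · exact hn
    rcases ReflTransGen.cases_head hn with rfl | ⟨n₁, hn₁, hn₂⟩
    · exact (hn' _ hu₁).elim
    -- Newman's argument: induction at `n₁` sends the common reduct `w` to `n`, so `u₁` reduces to
    -- `n`, and induction at `u₁` concludes.
    obtain ⟨w, h1, h2⟩ := beta_locally_confluent hn₁ hu₁
    exact ih u₁ hu₁ (h1.trans (ih n₁ hn₁ hn₂ hn' h2)) hn' hu₂

/-! ### Algebraic terms and `β`-reduction -/

/-- Terms built from variables, symbols and applications, in which no variable is applied;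
`Pat false` excludes the variables. -/
inductive Pat : Bool → Term F → Prop
  | var (n : ℕ) : Pat true (var n)
  | sym (b : Bool) (f : F) : Pat b (sym f)
  | app (b : Bool) {t u : Term F} : Pat false t → Pat true u → Pat b (app t u)

theorem Pat.toTrue {b : Bool} {t : Term F} (h : Pat b t) : Pat true t := by
  cases h with
  | var n => exact .var n
  | sym _ f => exact .sym _ f
  | app _ h1 h2 => exact .app _ h1 h2

theorem Pat.apps {ts : List (Term F)} (f : F) (h : ∀ t ∈ ts, Pat true t) :
    Pat false (apps (Term.sym f) ts) := by
  induction ts using List.reverseRecOn with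
  | nil => exact .sym _ f
  | append_singleton ts t ih =>
    rw [apps_concat]
    exact .app _ (ih fun u hu => h u (by simp [hu])) (h t (by simp))

theorem AlgebraicIn.pat {S : Signature F} {G : Set F} {t : Term F} (h : AlgebraicIn S G t) :
    Pat true t := by
  induction h with
  | var n => exact .var n
  | app f ts _ _ _ ih => exact (Pat.apps f ih).toTrue

theorem IsRule.pat {S : Signature F} {ρ : Rule F} (h : IsRule S ρ) : Pat false ρ.lhs := by
  have h1 := h.algebraic
  have h2 := h.not_var
  revert h1 h2
  generalize ρ.lhs = l
  intro h1 h2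
  cases h1 with
  | var n => exact (h2 n rfl).elim
  | app f ts _ _ h => exact Pat.apps f fun t ht => (h t ht).pat

/-- The head of the pattern is a symbol. Hence no `β`-redex overlaps a left-hand side above its
variables. -/
theorem Pat.subst_ne_lam {t : Term F} (h : Pat false t) (σ : ℕ → Term F) (A b : Term F) :
    subst σ t ≠ lam A b := by
  cases h <;> simp [subst]

theorem Pat.subst_congr {b : Bool} {t : Term F} (h : Pat b t) {σ τ : ℕ → Term F}
    (hστ : ∀ x, occ x t ≠ 0 → σ x = τ x) : subst σ t = subst τ t := by
  induction h with
  | var n => exact hστ n (by simp [occ])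
  | sym _ f => rfl
  | app _ _ _ ih1 ih2 =>
    simp only [subst]
    rw [ih1 fun x hx => hστ x (by simp only [occ]; omega),
      ih2 fun x hx => hστ x (by simp only [occ]; omega)]

theorem Pat.subst_update {b : Bool} {t : Term F} (h : Pat b t) (σ : ℕ → Term F) {x : ℕ}
    (hx : occ x t = 0) (s : Term F) : subst (Function.update σ x s) t = subst σ t :=
  h.subst_congr fun y hy => Function.update_of_ne (by rintro rfl; exact hy hx) _ _

theorem star_subst_update {J : Term F → Term F → Prop} (hc : CtxClosed J) (hs : SubstStable J)
    (t : Term F) {σ : ℕ → Term F} {x : ℕ} {s : Term F} (h : ReflTransGen J (σ x) s) :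
    ReflTransGen J (subst σ t) (subst (Function.update σ x s) t) := by
  refine subst_star hc hs t fun n => ?_
  by_cases hn : n = x
  · subst hn; simpa using h
  · rw [Function.update_of_ne hn]

/-- A `β`-step in an instance of an algebraic term takes place in the substitution. -/
theorem Pat.beta_subst {b : Bool} {l : Term F} (h : Pat b l) {σ : ℕ → Term F} {v : Term F}
    (hv : Beta (subst σ l) v) : ∃ x s, occ x l ≠ 0 ∧ Beta (σ x) s ∧
      ReflTransGen Beta v (subst (Function.update σ x s) l) ∧
      (occ x l ≤ 1 → v = subst (Function.update σ x s) l) := by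
  induction h generalizing v with
  | var n => exact ⟨n, v, by simp [occ], hv, by simp [subst, ReflTransGen.refl], by simp [subst]⟩
  | sym _ f =>
    cases hv with
    | root h => obtain ⟨_, _, _, h, _⟩ := h; cases h
  | @app _ l₁ l₂ hl₁ hl₂ ih1 ih2 =>
    cases hv with
    | root h =>
      obtain ⟨A, t, u, h, _⟩ := h
      simp only [subst, Term.app.injEq] at h
      exact (hl₁.subst_ne_lam _ _ _ h.1).elim
    | appL _ h =>
      obtain ⟨x, s, h1, h2, h3, h4⟩ := ih1 h
      refine ⟨x, s, by simp only [occ]; omega, h2, ?_, fun h5 => ?_⟩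
      · exact (beta_closed.star.appL _ h3).trans (beta_closed.star.appR _
          (star_subst_update beta_closed beta_stable _ (.single h2)))
      · simp only [occ] at h5
        rw [h4 (by omega)]
        simp only [subst]
        rw [hl₂.subst_update σ (by omega)]
    | appR _ h =>
      obtain ⟨x, s, h1, h2, h3, h4⟩ := ih2 h
      refine ⟨x, s, by simp only [occ]; omega, h2, ?_, fun h5 => ?_⟩
      · exact (beta_closed.star.appR _ h3).trans (beta_closed.star.appL _
          (star_subst_update beta_closed beta_stable _ (.single h2)))
      · simp only [occ] at h5
        rw [h4 (by omega)]
        simp only [subst]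
        rw [hl₁.subst_update σ (by omega)]

/-- A single occurrence of `x` makes this exactly one step, neither none nor several; this is where
linearity of equations pays off. -/
theorem Pat.beta_update {b : Bool} {r : Term F} (h : Pat b r) {σ : ℕ → Term F} {x : ℕ}
    {s : Term F} (hs : Beta (σ x) s) (hx : occ x r = 1) :
    Beta (subst σ r) (subst (Function.update σ x s) r) := by
  induction h with
  | var n =>
    obtain rfl : n = x := by by_contra hne; simp [occ, hne] at hx
    simpa [subst] using hs
  | sym _ f => simp [occ] at hx
  | @app _ l₁ l₂ hl₁ hl₂ ih1 ih2 =>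
    simp only [occ] at hx
    simp only [subst]
    rcases Nat.eq_zero_or_pos (occ x l₁) with h0 | h0
    · rw [hl₁.subst_update σ h0]
      exact .appR _ (ih2 (by omega))
    · rw [hl₂.subst_update σ (by omega)]
      exact .appL _ (ih1 (by omega))

theorem rewRoot_ne_lam {X : Set (Rule F)} (hX : ∀ ρ ∈ X, Pat false ρ.lhs) (A t b : Term F) :
    ¬ RewRoot X (lam A t) b := by
  rintro ⟨ρ, hρ, σ, h, _⟩
  exact (hX ρ hρ).subst_ne_lam _ _ _ h.symm

/-- Rewriting and `β`-reduction can be joined after some further `β`-steps. -/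
theorem rew_beta_join {X : Set (Rule F)} (hX : ∀ ρ ∈ X, Pat false ρ.lhs) {t u v : Term F}
    (hu : Rew X t u) (hv : Beta t v) : ∃ a, ReflTransGen Beta v a ∧
      ∃ b, ReflTransGen (Rew X) a b ∧ ReflTransGen Beta u b := by
  refine beta_commute (r := RewRoot X) (J := fun v u => ∃ a, ReflTransGen Beta v a ∧
    ∃ b, ReflTransGen (Rew X) a b ∧ ReflTransGen Beta u b) (rewRoot_stable X) (rewRoot_ne_lam hX)
    (beta_closed.star.comp ((rew_closed X).star.comp beta_closed.star.swap))
    (fun h1 h2 => ⟨_, .refl, _, h1, .single h2⟩) ?_ hu hv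
  rintro _ _ v ⟨ρ, hρ, σ, rfl, rfl⟩ hb
  obtain ⟨x, s, -, h2, h3, -⟩ := (hX ρ hρ).beta_subst hb
  -- The left-hand side may be non-linear: the rule matches again only after all copies of `σ x`
  -- have been contracted. The copies in the right-hand side are contracted on the other side.
  exact ⟨_, h3, _, .single (.root ⟨ρ, hρ, _, rfl, rfl⟩),
    star_subst_update beta_closed beta_stable _ (.single h2)⟩

/-- The hypotheses on the rules, on the equations and on their first-order parts. -/
structure FirstOrderSystem (S : Signature F) (R E : Set (Rule F)) (F₁ : Set F) : Prop where
  rule : ∀ ρ ∈ R, IsRule S ρ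
  equation : ∀ ρ ∈ E, IsRule S ρ
  symm : ∀ l r, (⟨l, r⟩ : Rule F) ∈ E ↔ (⟨r, l⟩ : Rule F) ∈ E
  rule_algebraic : ∀ ρ ∈ headedBy R F₁, AlgebraicIn S F₁ ρ.lhs ∧ AlgebraicIn S F₁ ρ.rhs
  equation_algebraic : ∀ ρ ∈ headedBy E F₁, AlgebraicIn S F₁ ρ.lhs ∧ AlgebraicIn S F₁ ρ.rhs
  sn : ∀ t, AlgebraicIn S F₁ t → SN (RewMod (headedBy E F₁) (headedBy R F₁)) t
  linear : ∀ ρ ∈ E, Linear ρ.lhs ∧ Linear ρ.rhs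

/-! ### Exchanging equations and reduction steps -/

section

variable {S : Signature F} {R E : Set (Rule F)} {F₁ : Set F}

namespace FirstOrderSystem

variable (h : FirstOrderSystem S R E F₁)

include h

theorem swap_mem {ρ : Rule F} (hρ : ρ ∈ E) : (⟨ρ.rhs, ρ.lhs⟩ : Rule F) ∈ E :=
  (h.symm _ _).1 hρ

/-- Symmetry gives inclusion of the free variables both ways, and linearity bounds both counts by
one. -/
theorem occ_eq {ρ : Rule F} (hρ : ρ ∈ E) (x : ℕ) : occ x ρ.rhs = occ x ρ.lhs := by
  have h1 : occ x ρ.rhs ≠ 0 → occ x ρ.lhs ≠ 0 := fun hx => (h.equation ρ hρ).fv_subset hx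
  have h2 : occ x ρ.lhs ≠ 0 → occ x ρ.rhs ≠ 0 :=
    fun hx => (h.equation _ (h.swap_mem hρ)).fv_subset hx
  have h3 := (h.linear ρ hρ).1 x
  have h4 := (h.linear ρ hρ).2 x
  omega

theorem rew_symm {t u : Term F} (ht : Rew E t u) : Rew E u t := by
  refine Ctx.le_of_closed (J := fun a b => Rew E b a) (rew_closed E).swap ?_ ht
  rintro _ _ ⟨ρ, hρ, σ, rfl, rfl⟩
  exact .root ⟨_, h.swap_mem hρ, σ, rfl, rfl⟩

theorem equ_symm {t u : Term F} (ht : Equ E t u) : Equ E u t := by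
  induction ht with
  | refl => exact .refl
  | tail _ h' ih => exact .head (h.rew_symm h') ih

/-- The contracted variable occurs exactly once on each side of the equation, so the `β`-step is
neither erased nor copied. -/
theorem rew_beta_commute {t u v : Term F} (hu : Rew E t u) (hv : Beta t v) :
    ∃ w, Equ E v w ∧ Beta u w := by
  refine beta_commute (r := RewRoot E) (J := fun v u => ∃ w, Equ E v w ∧ Beta u w)
    (rewRoot_stable E) (rewRoot_ne_lam fun ρ hρ => (h.equation ρ hρ).pat)
    ((rew_closed E).star.comp beta_closed.swap) (fun h1 h2 => ⟨_, h1, h2⟩) ?_ hu hv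
  rintro _ _ v ⟨ρ, hρ, σ, rfl, rfl⟩ hb
  obtain ⟨x, s, h1, h2, -, h4⟩ := (h.equation ρ hρ).pat.beta_subst hb
  have h5 := (h.linear ρ hρ).1 x
  rw [h4 h5]
  refine ⟨_, .single (.root ⟨ρ, hρ, _, rfl, rfl⟩), ?_⟩
  exact (h.equation _ (h.swap_mem hρ)).pat.beta_update h2 (by rw [h.occ_eq hρ]; omega)

theorem equ_beta_commute {t u v : Term F} (hu : Equ E t u) (hv : Beta t v) :
    ∃ w, Equ E v w ∧ Beta u w := by
  induction hu with
  | refl => exact ⟨v, .refl, hv⟩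
  | tail _ h' ih =>
    obtain ⟨w, h1, h2⟩ := ih
    obtain ⟨w', h3, h4⟩ := h.rew_beta_commute h' h2
    exact ⟨w', h1.trans h3, h4⟩

end FirstOrderSystem

/-- At least one step, followed by equations. -/
def Down (E R : Set (Rule F)) (t u : Term F) : Prop := ∃ x, TransGen (Step E R) t x ∧ Equ E x u

theorem Step.down {t u : Term F} (h : Step E R t u) : Down E R t u := ⟨u, .single h, .refl⟩

theorem Down.equ {t u v : Term F} (h : Down E R t u) (h' : Equ E u v) : Down E R t v :=
  let ⟨x, h1, h2⟩ := h
  ⟨x, h1, h2.trans h'⟩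

namespace FirstOrderSystem

variable (h : FirstOrderSystem S R E F₁)

include h

theorem equ_step {t u v : Term F} (hu : Equ E t u) (hv : Step E R u v) :
    ∃ w, Step E R t w ∧ Equ E w v := by
  rcases hv with hv | ⟨x, hx, hv⟩
  · obtain ⟨w, h1, h2⟩ := h.equ_beta_commute (h.equ_symm hu) hv
    exact ⟨w, .inl h2, h.equ_symm h1⟩
  · exact ⟨v, .inr ⟨x, hu.trans hx, hv⟩, .refl⟩

theorem equ_down {t u v : Term F} (hu : Equ E t u) (hv : Down E R u v) : Down E R t v := by
  obtain ⟨x, h1, h2⟩ := hv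
  suffices Down E R t x from this.equ h2
  clear h2
  induction h1 with
  | single h1 =>
    obtain ⟨w, h3, h4⟩ := h.equ_step hu h1
    exact ⟨w, .single h3, h4⟩
  | tail _ h1 ih =>
    obtain ⟨w, h3, h4⟩ := ih
    obtain ⟨w', h5, h6⟩ := h.equ_step h4 h1
    exact ⟨w', h3.tail h5, h6⟩

theorem down_trans {t u v : Term F} (hu : Down E R t u) (hv : Down E R u v) : Down E R t v := by
  obtain ⟨x, h1, h2⟩ := hu
  obtain ⟨y, h3, h4⟩ := h.equ_down h2 hv
  exact ⟨y, h1.trans h3, h4⟩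

/-- Equations can be postponed after steps, so an induction along nonempty step sequences succeeds
when it treats a whole equivalence class at once. -/
theorem acc_down {t : Term F} (ht : SN (Step E R) t) : Acc (fun b a => Down E R a b) t := by
  have key : Acc (TransGen fun b a => Step E R a b) t := Acc.transGen ht
  suffices ∀ u, Equ E t u → Acc (fun b a => Down E R a b) u from this t .refl
  clear ht
  induction key with
  | intro t _ ih =>
    refine fun u hu => ⟨_, fun v hv => ?_⟩
    obtain ⟨x, h1, h2⟩ := h.equ_down hu hv
    exact ih x (transGen_swap.2 h1) v h2

theorem sn_iff {t : Term F} : SN (Step E R) t ↔ Acc (fun b a => Down E R a b) t := by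
  refine ⟨h.acc_down, fun ht => ?_⟩
  exact Subrelation.accessible (fun hs => Step.down hs) ht

theorem sn_equ {t u : Term F} (ht : SN (Step E R) t) (hu : Equ E t u) : SN (Step E R) u := by
  refine ⟨_, fun v hv => ?_⟩
  exact h.sn_iff.2 ((h.acc_down ht).inv (h.equ_down hu hv.down))

theorem sn_down {t u : Term F} (ht : SN (Step E R) t) (hu : Down E R t u) : SN (Step E R) u :=
  h.sn_iff.2 ((h.acc_down ht).inv hu)

end FirstOrderSystem

end

/-! ### Subterms -/

/-- The subterm relation (a subterm below a binder keeps the bound variable free). -/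
inductive Sub (a : Term F) : Term F → Prop
  | refl : Sub a a
  | lamL {A} (t) : Sub a A → Sub a (lam A t)
  | lamR (A) {t} : Sub a t → Sub a (lam A t)
  | appL {t} (u) : Sub a t → Sub a (app t u)
  | appR (t) {u} : Sub a u → Sub a (app t u)
  | prodL {A} (B) : Sub a A → Sub a (prod A B)
  | prodR (A) {B} : Sub a B → Sub a (prod A B)

theorem Sub.trans {a b c : Term F} (h : Sub a b) (h' : Sub b c) : Sub a c := by
  induction h' with
  | refl => exact h
  | lamL t _ ih => exact .lamL _ ih
  | lamR t _ ih => exact .lamR _ ih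
  | appL t _ ih => exact .appL _ ih
  | appR t _ ih => exact .appR _ ih
  | prodL t _ ih => exact .prodL _ ih
  | prodR t _ ih => exact .prodR _ ih

/-- A context is a function on terms which may capture variables; this suffices, since only
compatibility with term constructors is used. -/
theorem Sub.exists_context {a s : Term F} (h : Sub a s) : ∃ C : Term F → Term F, C a = s ∧
    (∀ b, Sub b (C b)) ∧ ∀ J, CtxClosed J → ∀ b c, J b c → J (C b) (C c) := by
  induction h with
  | refl => exact ⟨id, rfl, fun _ => .refl, fun _ _ _ _ h => h⟩
  | lamL t _ ih =>
    obtain ⟨C, rfl, h2, h3⟩ := ih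
    exact ⟨fun b => lam (C b) t, rfl, fun b => .lamL _ (h2 b),
      fun J hJ b c h => hJ.lamL _ (h3 J hJ b c h)⟩
  | lamR t _ ih =>
    obtain ⟨C, rfl, h2, h3⟩ := ih
    exact ⟨fun b => lam t (C b), rfl, fun b => .lamR _ (h2 b),
      fun J hJ b c h => hJ.lamR _ (h3 J hJ b c h)⟩
  | appL t _ ih =>
    obtain ⟨C, rfl, h2, h3⟩ := ih
    exact ⟨fun b => app (C b) t, rfl, fun b => .appL _ (h2 b),
      fun J hJ b c h => hJ.appL _ (h3 J hJ b c h)⟩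
  | appR t _ ih =>
    obtain ⟨C, rfl, h2, h3⟩ := ih
    exact ⟨fun b => app t (C b), rfl, fun b => .appR _ (h2 b),
      fun J hJ b c h => hJ.appR _ (h3 J hJ b c h)⟩
  | prodL t _ ih =>
    obtain ⟨C, rfl, h2, h3⟩ := ih
    exact ⟨fun b => prod (C b) t, rfl, fun b => .prodL _ (h2 b),
      fun J hJ b c h => hJ.prodL _ (h3 J hJ b c h)⟩
  | prodR t _ ih =>
    obtain ⟨C, rfl, h2, h3⟩ := ih
    exact ⟨fun b => prod t (C b), rfl, fun b => .prodR _ (h2 b),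
      fun J hJ b c h => hJ.prodR _ (h3 J hJ b c h)⟩

/-! ### A well-founded relation on equivalence classes -/

section

variable {S : Signature F} {R E : Set (Rule F)} {F₁ : Set F}

theorem step_closed : CtxClosed (Step E R) where
  lamL t := Or.imp (beta_closed.lamL t) (((rew_closed E).star.comp (rew_closed R)).lamL t)
  lamR t _ _ := Or.imp (beta_closed.lamR t) (((rew_closed E).star.comp (rew_closed R)).lamR t)
  appL t := Or.imp (beta_closed.appL t) (((rew_closed E).star.comp (rew_closed R)).appL t)
  appR t _ _ := Or.imp (beta_closed.appR t) (((rew_closed E).star.comp (rew_closed R)).appR t)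
  prodL t := Or.imp (beta_closed.prodL t) (((rew_closed E).star.comp (rew_closed R)).prodL t)
  prodR t _ _ := Or.imp (beta_closed.prodR t) (((rew_closed E).star.comp (rew_closed R)).prodR t)

theorem Sub.sn {a s : Term F} (h : Sub a s) (hs : SN (Step E R) s) : SN (Step E R) a := by
  obtain ⟨C, rfl, -, h3⟩ := h.exists_context
  exact Subrelation.accessible (fun hbc => h3 _ step_closed _ _ hbc) (InvImage.accessible C hs)

theorem Down.context {C : Term F → Term F}
    (hC : ∀ J : Term F → Term F → Prop, CtxClosed J → ∀ b c, J b c → J (C b) (C c))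
    {a b : Term F} (h : Down E R a b) : Down E R (C a) (C b) := by
  obtain ⟨x, h1, h2⟩ := h
  exact ⟨C x, TransGen.lift C (fun _ _ => hC _ step_closed _ _) _ _ h1,
    hC _ (rew_closed E).star _ _ h2⟩

/-- The class of a term modulo the equations. -/
def cls (E : Set (Rule F)) (t : Term F) : Set (Term F) := {u | Equ E t u}

theorem FirstOrderSystem.cls_eq (h : FirstOrderSystem S R E F₁) {t u : Term F} :
    cls E t = cls E u ↔ Equ E t u := by
  refine ⟨fun htu => ?_, fun htu => ?_⟩
  · have : u ∈ cls E u := ReflTransGen.refl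
    rwa [← htu] at this
  · ext v
    exact ⟨(h.equ_symm htu).trans, htu.trans⟩

/-- The class `B` contains a subterm of a reduct of a strongly normalizing term in `A`. -/
def ClsLT (E R : Set (Rule F)) (B A : Set (Term F)) : Prop :=
  ∃ a b c, SN (Step E R) a ∧ A = cls E a ∧ Down E R a b ∧ Sub c b ∧ B = cls E c

/-- A descent among classes is followed inside one strongly normalizing term: reducing a subterm
reduces the whole, and the next class is that of a subterm of the result. Classes without a strongly
normalizing term have nothing below them, by definition of `ClsLT`. -/
theorem FirstOrderSystem.wellFounded_clsLT (h : FirstOrderSystem S R E F₁) :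
    WellFounded (ClsLT E R) := by
  have key : ∀ s, SN (Step E R) s → ∀ a, Sub a s → Acc (ClsLT E R) (cls E a) := by
    intro s hs
    induction h.acc_down hs with
    | intro s _ ih =>
      refine fun a ha => ⟨_, ?_⟩
      rintro _ ⟨a₁, b, c, -, h1, h2, h3, rfl⟩
      obtain ⟨C, rfl, h4, h5⟩ := ha.exists_context
      have hd : Down E R (C a) (C b) := (h.equ_down (h.cls_eq.1 h1) h2).context h5
      exact ih _ hd (h.sn_down hs hd) c (h3.trans (h4 b))
  refine ⟨fun A => ⟨_, ?_⟩⟩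
  rintro _ ⟨a, b, c, h0, -, h2, h3, rfl⟩
  exact key b (h.sn_down h0 h2) c h3

end

/-! ### First-order caps and aliens -/

/-- `Spine g k t`: the term `t` is the symbol `g` applied to `k` arguments. -/
inductive Spine (g : F) : ℕ → Term F → Prop
  | sym : Spine g 0 (Term.sym g)
  | app {k t} (u) : Spine g k t → Spine g (k + 1) (app t u)

theorem spine_apps (g : F) (us : List (Term F)) : Spine g us.length (apps (sym g) us) := by
  induction us using List.reverseRecOn with
  | nil => exact .sym
  | append_singleton us u ih =>
    rw [apps_concat, List.length_append]
    exact .app u ih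

theorem Spine.exists_apps {g : F} {k : ℕ} {t : Term F} (h : Spine g k t) :
    ∃ us, us.length = k ∧ t = apps (Term.sym g) us := by
  induction h with
  | sym => exact ⟨[], rfl, rfl⟩
  | app u _ ih =>
    obtain ⟨us, rfl, rfl⟩ := ih
    exact ⟨us ++ [u], by simp, (apps_concat _ _ _).symm⟩

theorem Spine.unique {g g' : F} {k k' : ℕ} {t : Term F} (h : Spine g k t) (h' : Spine g' k' t) :
    g = g' ∧ k = k' := by
  induction h generalizing k' with
  | sym => cases h'; exact ⟨rfl, rfl⟩
  | app u _ ih =>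
    cases h' with
    | app _ h' => obtain ⟨rfl, rfl⟩ := ih h'; exact ⟨rfl, rfl⟩

theorem subst_apps (σ : ℕ → Term F) (t : Term F) (us : List (Term F)) :
    subst σ (apps t us) = apps (subst σ t) (us.map (subst σ)) := by
  induction us using List.reverseRecOn with
  | nil => rfl
  | append_singleton us u ih =>
    rw [List.map_append, List.map_singleton, apps_concat, apps_concat, ← ih]; rfl

section

variable (S : Signature F) (F₁ : Set F)

/-- The term is headed by a symbol of `F₁` applied to as many arguments as its arity. -/
def Fst (t : Term F) : Prop := ∃ g ∈ F₁, Spine g (S.arity g) t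

open Classical in
/-- The cap of a term headed by a first-order symbol, its aliens being mapped by `φ`. -/
noncomputable def scap (φ : Term F → Term F) : Term F → Term F
  | app t u => app (scap φ t) (if Fst S F₁ u then scap φ u else φ u)
  | t => t

open Classical in
/-- The first-order cap of a term: its maximal subterms that are not headed by a fully applied
first-order symbol are mapped by `φ`. -/
noncomputable def cap (φ : Term F → Term F) (t : Term F) : Term F :=
  if Fst S F₁ t then scap S F₁ φ t else φ t

open Classical in
/-- The aliens of a term headed by a first-order symbol. -/
noncomputable def saliens : Term F → Multiset (Term F)
  | app t u => saliens t + if Fst S F₁ u then saliens u else {u}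
  | _ => 0

open Classical in
/-- The aliens of a term: its maximal subterms that are not headed by a fully applied first-order
symbol. -/
noncomputable def aliens (t : Term F) : Multiset (Term F) :=
  if Fst S F₁ t then saliens S F₁ t else {t}

variable {S F₁}

theorem scap_app (φ : Term F → Term F) (t u : Term F) :
    scap S F₁ φ (app t u) = app (scap S F₁ φ t) (cap S F₁ φ u) := rfl

theorem saliens_app (t u : Term F) :
    saliens S F₁ (app t u) = saliens S F₁ t + aliens S F₁ u := rfl

theorem Fst.cap {t : Term F} (h : Fst S F₁ t) (φ) : cap S F₁ φ t = scap S F₁ φ t := if_pos h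
theorem Fst.aliens {t : Term F} (h : Fst S F₁ t) : aliens S F₁ t = saliens S F₁ t := if_pos h
theorem cap_of_not_fst {t : Term F} (h : ¬ Fst S F₁ t) (φ) : cap S F₁ φ t = φ t := if_neg h
theorem aliens_of_not_fst {t : Term F} (h : ¬ Fst S F₁ t) : aliens S F₁ t = {t} := if_neg h

theorem sub_of_mem_saliens {t a : Term F} (h : a ∈ saliens S F₁ t) : Sub a t := by
  induction t with
  | app t u iht ihu =>
    rw [saliens_app, Multiset.mem_add] at h
    rcases h with h | h
    · exact .appL _ (iht h)
    · refine .appR _ ?_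
      by_cases hu : Fst S F₁ u
      · exact ihu (hu.aliens ▸ h)
      · rw [aliens_of_not_fst hu, Multiset.mem_singleton] at h
        exact h ▸ .refl
  | _ => simp [saliens] at h

theorem sub_of_mem_aliens {t a : Term F} (h : a ∈ aliens S F₁ t) : Sub a t := by
  by_cases ht : Fst S F₁ t
  · exact sub_of_mem_saliens (ht.aliens ▸ h)
  · rw [aliens_of_not_fst ht, Multiset.mem_singleton] at h
    exact h ▸ .refl

theorem exists_mem_of_mem_saliens_apps (g : F) {us : List (Term F)} {a : Term F}
    (h : a ∈ saliens S F₁ (apps (sym g) us)) : ∃ u ∈ us, Sub a u := by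
  induction us using List.reverseRecOn with
  | nil => simp [apps, saliens] at h
  | append_singleton us u ih =>
    rw [apps_concat, saliens_app, Multiset.mem_add] at h
    rcases h with h | h
    · obtain ⟨v, hv, hs⟩ := ih h
      exact ⟨v, by simp [hv], hs⟩
    · exact ⟨u, by simp, sub_of_mem_aliens h⟩

theorem cap_algebraic {φ : Term F → Term F} (hφ : ∀ a, AlgebraicIn S F₁ (φ a)) (t : Term F) :
    AlgebraicIn S F₁ (cap S F₁ φ t) := by
  -- The induction must cover partial applications, whose `scap` is not algebraic by itself; this
  -- passes from spines to complete caps.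
  have wrap : ∀ t, (∀ g k, Spine g k t → ∃ us, us.length = k ∧
      scap S F₁ φ t = apps (sym g) us ∧ ∀ u ∈ us, AlgebraicIn S F₁ u) →
      AlgebraicIn S F₁ (cap S F₁ φ t) := by
    intro t h
    by_cases ht : Fst S F₁ t
    · rw [ht.cap]
      obtain ⟨g, hg, hs⟩ := ht
      obtain ⟨us, h1, h2, h3⟩ := h g _ hs
      rw [h2]
      exact .app g us hg h1 h3
    · rw [cap_of_not_fst ht]
      exact hφ t
  apply wrap
  induction t with
  | sym f =>
    intro g k h
    cases h
    exact ⟨[], rfl, rfl, by simp⟩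
  | app t u iht ihu =>
    intro g k h
    cases h with
    | app _ h =>
      obtain ⟨us, rfl, h2, h3⟩ := iht g _ h
      refine ⟨us ++ [cap S F₁ φ u], by simp, ?_, ?_⟩
      · rw [apps_concat, scap_app, h2]
      · intro v hv
        rcases List.mem_append.1 hv with hv | hv
        · exact h3 v hv
        · rw [List.mem_singleton.1 hv]
          exact wrap u ihu
  | _ => intro g k h; cases h

/-- A step in a term takes place either in an alien or at the root of a subterm of the cap. -/
theorem Ctx.decompose {r : Term F → Term F → Prop}
    (hr : ∀ {a b g k}, g ∈ F₁ → r a b → Spine g k a → k = S.arity g) {t t' : Term F}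
    (h : Ctx r t t') :
    (∃ p p' K, ((¬ Fst S F₁ p ∧ Ctx r p p') ∨ (Fst S F₁ p ∧ r p p')) ∧
      aliens S F₁ t = K + aliens S F₁ p ∧ aliens S F₁ t' = K + aliens S F₁ p' ∧
      ∀ φ J, CtxClosed J → J (cap S F₁ φ p) (cap S F₁ φ p') →
        J (cap S F₁ φ t) (cap S F₁ φ t')) ∧
    ∀ g ∈ F₁, ∀ k ≤ S.arity g, Spine g k t → r t t' ∨ (Spine g k t' ∧
      ∃ p p' K, ((¬ Fst S F₁ p ∧ Ctx r p p') ∨ (Fst S F₁ p ∧ r p p')) ∧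
        saliens S F₁ t = K + aliens S F₁ p ∧ saliens S F₁ t' = K + aliens S F₁ p' ∧
        ∀ φ J, CtxClosed J → J (cap S F₁ φ p) (cap S F₁ φ p') →
          J (scap S F₁ φ t) (scap S F₁ φ t')) := by
  -- The statement on spines with `k` arguments is the one proved by induction, since a step below a
  -- first-order head is reached through its partial applications.
  suffices hw : _ by
    refine ⟨?_, hw⟩
    by_cases ht : Fst S F₁ t
    · obtain ⟨g, hg, hs⟩ := id ht
      rcases hw g hg _ le_rfl hs with h' | ⟨hs', p, p', K, h1, h2, h3, h4⟩
      · exact ⟨t, t', 0, .inr ⟨ht, h'⟩, by simp, by simp, fun _ _ _ h => h⟩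
      · have ht' : Fst S F₁ t' := ⟨g, hg, hs'⟩
        refine ⟨p, p', K, h1, by rw [ht.aliens, h2], by rw [ht'.aliens, h3], fun φ J hJ hp => ?_⟩
        rw [ht.cap, ht'.cap]
        exact h4 φ J hJ hp
    · exact ⟨t, t', 0, .inl ⟨ht, h⟩, by simp, by simp, fun _ _ _ h => h⟩
  induction h with
  | root h => exact fun g hg k _ _ => .inl h
  | lamL => intro g hg k _ h; cases h
  | lamR => intro g hg k _ h; cases h
  | prodL => intro g hg k _ h; cases h
  | prodR => intro g hg k _ h; cases h
  | appL u h ih =>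
    intro g hg k hk hs
    cases hs with
    | app _ hs =>
      rcases ih g hg _ (Nat.le_of_succ_le hk) hs with h' | ⟨hs', p, p', K, h1, h2, h3, h4⟩
      · have := hr hg h' hs
        omega
      · refine .inr ⟨.app _ hs', p, p', K + aliens S F₁ u, h1, ?_, ?_, fun φ J hJ hp => ?_⟩
        · rw [saliens_app, h2, add_right_comm]
        · rw [saliens_app, h3, add_right_comm]
        · exact hJ.appL _ (h4 φ J hJ hp)
  | @appR t u u' h ih =>
    intro g hg k hk hs
    cases hs with
    | app _ hs =>
      refine .inr ⟨.app _ hs, ?_⟩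
      suffices hw : ∃ p p' K, ((¬ Fst S F₁ p ∧ Ctx r p p') ∨ (Fst S F₁ p ∧ r p p')) ∧
          aliens S F₁ u = K + aliens S F₁ p ∧ aliens S F₁ u' = K + aliens S F₁ p' ∧
          ∀ φ J, CtxClosed J → J (cap S F₁ φ p) (cap S F₁ φ p') →
            J (cap S F₁ φ u) (cap S F₁ φ u') by
        obtain ⟨p, p', K, h1, h2, h3, h4⟩ := hw
        refine ⟨p, p', saliens S F₁ t + K, h1, ?_, ?_, fun φ J hJ hp => ?_⟩
        · rw [saliens_app, h2, add_assoc]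
        · rw [saliens_app, h3, add_assoc]
        · exact hJ.appR _ (h4 φ J hJ hp)
      by_cases ht : Fst S F₁ u
      · obtain ⟨g, hg, hs⟩ := id ht
        rcases ih g hg _ le_rfl hs with h' | ⟨hs', p, p', K, h1, h2, h3, h4⟩
        · exact ⟨u, u', 0, .inr ⟨ht, h'⟩, by simp, by simp, fun _ _ _ h => h⟩
        · have ht' : Fst S F₁ u' := ⟨g, hg, hs'⟩
          refine ⟨p, p', K, h1, by rw [ht.aliens, h2], by rw [ht'.aliens, h3], fun φ J hJ hp => ?_⟩
          rw [ht.cap, ht'.cap]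
          exact h4 φ J hJ hp
      · exact ⟨u, u', 0, .inl ⟨ht, h⟩, by simp, by simp, fun _ _ _ h => h⟩

end

/-- The multiset of the variables of a term without binders. -/
def vars : Term F → Multiset ℕ
  | var n => {n}
  | app t u => vars t + vars u
  | _ => 0

theorem Pat.count_vars {b : Bool} {t : Term F} (h : Pat b t) (x : ℕ) :
    (vars t).count x = occ x t := by
  induction h with
  | var n => simp [vars, occ, Multiset.count_singleton, eq_comm]
  | sym => rfl
  | app _ _ _ ih1 ih2 => simp [vars, occ, ih1, ih2]

/-! ### Steps seen through caps and aliens -/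

section

variable {S : Signature F} {R E : Set (Rule F)} {F₁ : Set F}

theorem AlgebraicIn.fst_subst {l : Term F} (h : AlgebraicIn S F₁ l) (hv : ∀ n, l ≠ Term.var n)
    (σ : ℕ → Term F) : Fst S F₁ (subst σ l) := by
  cases h with
  | var n => exact (hv n rfl).elim
  | app f ts hf hl h =>
    refine ⟨f, hf, ?_⟩
    rw [subst_apps, ← hl, ← List.length_map (subst σ)]
    exact spine_apps _ _

/-- The symbols of `l` are fully applied and in `F₁`, so they all belong to the cap of the instance,
and aliens come only from the variables. -/
theorem AlgebraicIn.cap_aliens {l : Term F} (h : AlgebraicIn S F₁ l) (σ : ℕ → Term F) :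
    aliens S F₁ (subst σ l) = (vars l).bind (fun x => aliens S F₁ (σ x)) ∧
    ∀ φ, cap S F₁ φ (subst σ l) = subst (fun x => cap S F₁ φ (σ x)) l := by
  induction h with
  | var n => simp [subst, vars]
  | app f ts hf hl h ih =>
    have hfst : Fst S F₁ (subst σ (apps (sym f) ts)) :=
      (AlgebraicIn.app f ts hf hl h).fst_subst (by
        intro n hn
        have := spine_apps f ts
        rw [hn] at this
        revert this
        generalize ts.length = k
        intro h
        cases h) σ
    rw [hfst.aliens]
    simp only [hfst.cap]
    clear hfst hl h
    induction ts using List.reverseRecOn with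
    | nil => simp [apps, subst, vars, saliens, scap]
    | append_singleton ts t ih' =>
      obtain ⟨h1, h2⟩ := ih' fun u hu => ih u (by simp [hu])
      obtain ⟨h3, h4⟩ := ih t (by simp)
      rw [apps_concat]
      simp only [subst, saliens_app, scap_app, vars, Multiset.add_bind, h1, h2, h3, h4,
        implies_true, and_self]

/-- The head of a left-hand side has exactly as many arguments as its arity, so partial and
over-applied symbols are never redexes at the root. -/
theorem IsRule.spine {ρ : Rule F} (h : IsRule S ρ) {g : F} {k : ℕ} {σ : ℕ → Term F}
    (hs : Spine g k (subst σ ρ.lhs)) : k = S.arity g ∧ ∃ ts, ρ.lhs = apps (sym g) ts := by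
  have h1 := h.algebraic
  have h2 := h.not_var
  revert h1 h2 hs
  generalize ρ.lhs = l
  intro hs h1 h2
  cases h1 with
  | var n => exact (h2 n rfl).elim
  | app f ts _ hl h =>
    rw [subst_apps] at hs
    obtain ⟨rfl, h4⟩ := hs.unique (spine_apps f _)
    exact ⟨by simpa [hl] using h4, ts, rfl⟩

theorem rewRoot_spine {X : Set (Rule F)} (hX : ∀ ρ ∈ X, IsRule S ρ) {a b : Term F} {g : F} {k : ℕ}
    (hg : g ∈ F₁) (h : RewRoot X a b) (hs : Spine g k a) :
    k = S.arity g ∧ RewRoot (headedBy X F₁) a b := by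
  obtain ⟨ρ, hρ, σ, rfl, rfl⟩ := h
  obtain ⟨h1, ts, h2⟩ := (hX ρ hρ).spine hs
  exact ⟨h1, ρ, ⟨hρ, g, hg, ts, h2⟩, σ, rfl, rfl⟩

theorem Rew.decompose {X : Set (Rule F)} (hX : ∀ ρ ∈ X, IsRule S ρ) {t t' : Term F}
    (h : Rew X t t') :
    ∃ p p' K, ((¬ Fst S F₁ p ∧ Rew X p p') ∨ (Fst S F₁ p ∧ RewRoot (headedBy X F₁) p p')) ∧
      aliens S F₁ t = K + aliens S F₁ p ∧ aliens S F₁ t' = K + aliens S F₁ p' ∧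
      ∀ φ J, CtxClosed J → J (cap S F₁ φ p) (cap S F₁ φ p') →
        J (cap S F₁ φ t) (cap S F₁ φ t') := by
  obtain ⟨⟨p, p', K, h1, h2⟩, -⟩ := Ctx.decompose (S := S) (F₁ := F₁) (r := RewRoot X)
    (fun hg h hs => (rewRoot_spine hX hg h hs).1) h
  refine ⟨p, p', K, h1.imp_right fun ⟨⟨g, hg, hs⟩, h4⟩ => ⟨⟨g, hg, hs⟩, ?_⟩, h2⟩
  exact (rewRoot_spine hX hg h4 hs).2

theorem Beta.decompose {t t' : Term F} (h : Beta t t') :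
    ∃ p p' K, ¬ Fst S F₁ p ∧ Beta p p' ∧
      aliens S F₁ t = K + {p} ∧ aliens S F₁ t' = K + aliens S F₁ p' ∧
      ∀ φ J, CtxClosed J → J (φ p) (cap S F₁ φ p') → J (cap S F₁ φ t) (cap S F₁ φ t') := by
  have hr : ∀ {a b : Term F} {g k}, BetaRoot a b → ¬ Spine g k a := by
    rintro _ _ g k ⟨A, t, u, rfl, -⟩ hs
    cases hs with
    | app _ hs => cases hs
  obtain ⟨⟨p, p', K, h1, h2, h3⟩, -⟩ := Ctx.decompose (S := S) (F₁ := F₁) (r := BetaRoot)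
    (fun _ h hs => (hr h hs).elim) h
  rcases h1 with ⟨h1, h4⟩ | ⟨⟨g, hg, hs⟩, h4⟩
  · rw [aliens_of_not_fst h1] at h2
    refine ⟨p, p', K, h1, h4, h2, h3.1, fun φ J hJ hp => h3.2 φ J hJ ?_⟩
    rwa [cap_of_not_fst h1]
  · exact (hr h4 hs).elim

/-- A step in the cap remains an instance of the same rule, with the substitution composed with the
cap; steps in aliens are left to `hφ`. -/
theorem Rew.cap {X : Set (Rule F)} (hX : ∀ ρ ∈ X, IsRule S ρ)
    (hX₁ : ∀ ρ ∈ headedBy X F₁, AlgebraicIn S F₁ ρ.lhs ∧ AlgebraicIn S F₁ ρ.rhs)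
    {φ : Term F → Term F} {J : Term F → Term F → Prop} (hJ : CtxClosed J)
    (h₁ : ∀ a b, Rew (headedBy X F₁) a b → J a b) {t t' : Term F} (ht : Rew X t t')
    (hφ : ∀ p p', p ∈ aliens S F₁ t → ¬ Fst S F₁ p → Rew X p p' → J (φ p) (cap S F₁ φ p')) :
    J (cap S F₁ φ t) (cap S F₁ φ t') := by
  obtain ⟨p, p', K, h1, h2, h3, h4⟩ := Rew.decompose (F₁ := F₁) hX ht
  refine h4 φ J hJ ?_
  rcases h1 with ⟨h1, h5⟩ | ⟨-, ρ, hρ, σ, rfl, rfl⟩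
  · rw [aliens_of_not_fst h1] at h2
    rw [cap_of_not_fst h1]
    exact hφ p p' (by simp [h2]) h1 h5
  · rw [((hX₁ ρ hρ).1.cap_aliens σ).2, ((hX₁ ρ hρ).2.cap_aliens σ).2]
    exact h₁ _ _ (.root ⟨ρ, hρ, _, rfl, rfl⟩)

namespace FirstOrderSystem

variable (h : FirstOrderSystem S R E F₁)

include h

/-- By symmetry neither side of an equation is a variable, so equations never collapse a first-order
head. -/
theorem fst_rew {t t' : Term F} (ht : Rew E t t') (hf : Fst S F₁ t) : Fst S F₁ t' := by
  obtain ⟨g, hg, hs⟩ := hf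
  obtain ⟨-, h1⟩ := Ctx.decompose (S := S) (F₁ := F₁) (r := RewRoot E)
    (fun hg h' hs => (rewRoot_spine h.equation hg h' hs).1) ht
  rcases h1 g hg _ le_rfl hs with h1 | ⟨h1, -⟩
  · obtain ⟨ρ, hρ, σ, rfl, rfl⟩ := (rewRoot_spine h.equation hg h1 hs).2
    exact (h.equation_algebraic ρ hρ).2.fst_subst
      (h.equation _ (h.swap_mem hρ.1)).not_var σ
  · exact ⟨g, hg, h1⟩

theorem not_fst_rew {t t' : Term F} (ht : Rew E t t') (hf : ¬ Fst S F₁ t) : ¬ Fst S F₁ t' :=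
  fun h' => hf (h.fst_rew (h.rew_symm ht) h')

/-- Equational steps permute the aliens, up to equivalence. -/
theorem map_cls_aliens_rew {t t' : Term F} (ht : Rew E t t') :
    (aliens S F₁ t).map (cls E) = (aliens S F₁ t').map (cls E) := by
  obtain ⟨p, p', K, h1, h2, h3, -⟩ := Rew.decompose (F₁ := F₁) h.equation ht
  rw [h2, h3, Multiset.map_add, Multiset.map_add]
  congr 1
  rcases h1 with ⟨h1, h4⟩ | ⟨-, ρ, hρ, σ, rfl, rfl⟩
  · rw [aliens_of_not_fst h1, aliens_of_not_fst (h.not_fst_rew h4 h1)]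
    simp only [Multiset.map_singleton]
    rw [h.cls_eq.2 (ReflTransGen.single h4)]
  · rw [((h.equation_algebraic ρ hρ).1.cap_aliens σ).1,
      ((h.equation_algebraic ρ hρ).2.cap_aliens σ).1]
    -- Both sides of the equation have the same multiset of variables.
    congr 2
    ext x
    rw [(h.equation_algebraic ρ hρ).1.pat.count_vars, (h.equation_algebraic ρ hρ).2.pat.count_vars,
      h.occ_eq hρ.1]

theorem map_cls_aliens_equ {t t' : Term F} (ht : Equ E t t') :
    (aliens S F₁ t).map (cls E) = (aliens S F₁ t').map (cls E) := by
  induction ht with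
  | refl => rfl
  | tail _ h' ih => rw [ih, h.map_cls_aliens_rew h']

/-- A rewrite step takes place either in an alien or in the cap. -/
theorem rew_cases {t t' : Term F} (ht : Rew R t t') :
    (∃ p p' K, ¬ Fst S F₁ p ∧ Rew R p p' ∧
      aliens S F₁ t = K + {p} ∧ aliens S F₁ t' = K + aliens S F₁ p' ∧
      ∀ φ J, CtxClosed J → J (φ p) (cap S F₁ φ p') → J (cap S F₁ φ t) (cap S F₁ φ t')) ∨
    ((∀ φ, Rew (headedBy R F₁) (cap S F₁ φ t) (cap S F₁ φ t')) ∧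
      (∀ a ∈ aliens S F₁ t', a ∈ aliens S F₁ t) ∧
      ((∀ ρ ∈ headedBy R F₁, NonDuplicating ρ) → aliens S F₁ t' ≤ aliens S F₁ t)) := by
  obtain ⟨p, p', K, h1, h2, h3, h4⟩ := Rew.decompose (F₁ := F₁) h.rule ht
  rcases h1 with ⟨h1, h5⟩ | ⟨-, ρ, hρ, σ, rfl, rfl⟩
  · rw [aliens_of_not_fst h1] at h2
    refine .inl ⟨p, p', K, h1, h5, h2, h3, fun φ J hJ hp => h4 φ J hJ ?_⟩
    rwa [cap_of_not_fst h1]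
  · have hl := (h.rule_algebraic ρ hρ).1
    have hr := (h.rule_algebraic ρ hρ).2
    rw [(hl.cap_aliens σ).1] at h2
    rw [(hr.cap_aliens σ).1] at h3
    refine .inr ⟨fun φ => h4 φ _ (rew_closed _) ?_, ?_, fun hn => ?_⟩
    · rw [(hl.cap_aliens σ).2, (hr.cap_aliens σ).2]
      exact .root ⟨ρ, hρ, _, rfl, rfl⟩
    · intro a ha
      rw [h3, Multiset.mem_add, Multiset.mem_bind] at ha
      rw [h2, Multiset.mem_add, Multiset.mem_bind]
      refine ha.imp_right fun ⟨x, hx, hax⟩ => ⟨x, ?_, hax⟩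
      rw [← Multiset.count_ne_zero, hr.pat.count_vars] at hx
      rw [← Multiset.count_ne_zero, hl.pat.count_vars]
      exact (h.rule ρ hρ.1).fv_subset hx
    · have hle : vars ρ.rhs ≤ vars ρ.lhs := by
        rw [Multiset.le_iff_count]
        intro x
        rw [hr.pat.count_vars, hl.pat.count_vars]
        exact hn ρ hρ x
      obtain ⟨M, hM⟩ := Multiset.le_iff_exists_add.1 hle
      rw [h2, h3, hM, Multiset.add_bind, ← add_assoc]
      exact Multiset.le_add_right _ _

end FirstOrderSystem

end

section

variable {S : Signature F} {R E : Set (Rule F)} {F₁ : Set F}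

/-! ### Reduction of caps -/

theorem CtxClosed.or {J K : Term F → Term F → Prop} (hJ : CtxClosed J) (hK : CtxClosed K) :
    CtxClosed fun a b => J a b ∨ K a b where
  lamL t := Or.imp (hJ.lamL t) (hK.lamL t)
  lamR t _ _ := Or.imp (hJ.lamR t) (hK.lamR t)
  appL t := Or.imp (hJ.appL t) (hK.appL t)
  appR t _ _ := Or.imp (hJ.appR t) (hK.appR t)
  prodL t := Or.imp (hJ.prodL t) (hK.prodL t)
  prodR t _ _ := Or.imp (hJ.prodR t) (hK.prodR t)

theorem Rew.of_union {X Y : Set (Rule F)} {t u : Term F} (h : Rew (X ∪ Y) t u) :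
    Rew X t u ∨ Rew Y t u := by
  refine Ctx.le_of_closed ((rew_closed X).or (rew_closed Y)) ?_ h
  rintro a b ⟨ρ, hρ | hρ, hσ⟩
  · exact .inl (.root ⟨ρ, hρ, hσ⟩)
  · exact .inr (.root ⟨ρ, hρ, hσ⟩)

theorem headedBy_union (X Y : Set (Rule F)) (G : Set F) :
    headedBy (X ∪ Y) G = headedBy X G ∪ headedBy Y G := by
  ext ρ
  simp only [headedBy, Set.mem_union, Set.mem_ofPred_eq, or_and_right]

variable (R E F₁) in
/-- Rewriting of caps with first-order rules and equations, in any number of steps. -/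
def CapLE : Term F → Term F → Prop := ReflTransGen (Rew (headedBy (R ∪ E) F₁))

variable (R E F₁) in
/-- Rewriting of caps ending with a first-order rule. -/
def CapLT (c c' : Term F) : Prop := ∃ x, CapLE R E F₁ c x ∧ Rew (headedBy R F₁) x c'

theorem capLE_closed : CtxClosed (CapLE R E F₁) := (rew_closed _).star

theorem CapLE.of_equation {a b : Term F} (h : Rew (headedBy E F₁) a b) : CapLE R E F₁ a b :=
  .single (h.mono (by rw [headedBy_union]; exact Set.subset_union_right))

theorem CapLE.exists_equ {c x : Term F} (h : CapLE R E F₁ c x) :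
    ∃ z, ReflTransGen (RewMod (headedBy E F₁) (headedBy R F₁)) c z ∧
      Equ (headedBy E F₁) z x := by
  induction h with
  | refl => exact ⟨c, .refl, .refl⟩
  | tail _ h' ih =>
    obtain ⟨z, h1, h2⟩ := ih
    rw [headedBy_union] at h'
    rcases h'.of_union with h' | h'
    · exact ⟨_, h1.tail ⟨_, h2, h'⟩, .refl⟩
    · exact ⟨z, h1, h2.tail h'⟩

namespace FirstOrderSystem

variable (h : FirstOrderSystem S R E F₁)

include h

/-- Equations between two rule steps are absorbed in rewriting modulo, so each `CapLT` step contains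
at least one step of the terminating relation. -/
theorem acc_capLT {c : Term F} (hc : AlgebraicIn S F₁ c) :
    Acc (fun b a => CapLT R E F₁ a b) c := by
  refine Subrelation.accessible ?_ (Acc.transGen (h.sn c hc))
  rintro a b ⟨x, h1, h2⟩
  obtain ⟨z, h3, h4⟩ := h1.exists_equ
  exact transGen_swap.2 (TransGen.tail' h3 ⟨x, h4, h2⟩)

theorem mem_aliens_rew {t u a : Term F} (ht : Rew E t u) (ha : a ∈ aliens S F₁ u) :
    ∃ b ∈ aliens S F₁ t, Equ E b a := by
  have h1 := Multiset.mem_map_of_mem (cls E) ha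
  rw [← h.map_cls_aliens_rew ht, Multiset.mem_map] at h1
  obtain ⟨b, hb, hba⟩ := h1
  exact ⟨b, hb, h.cls_eq.1 hba⟩

end FirstOrderSystem

/-- A step in a strongly normalizing alien makes the multiset of aliens decrease. -/
theorem cutExpand_aliens {t t' p p' : Term F} {K : Multiset (Term F)} (hp : SN (Step E R) p)
    (hd : Step E R p p') (ht : aliens S F₁ t = K + {p})
    (ht' : aliens S F₁ t' = K + aliens S F₁ p') :
    CutExpand (ClsLT E R) ((aliens S F₁ t').map (cls E)) ((aliens S F₁ t).map (cls E)) := by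
  refine ⟨(aliens S F₁ p').map (cls E), cls E p, ?_, ?_⟩
  · intro B hB
    obtain ⟨c, hc, rfl⟩ := Multiset.mem_map.1 hB
    exact ⟨p, p', c, hp, rfl, hd.down, sub_of_mem_aliens hc, rfl⟩
  · rw [ht, ht', Multiset.map_add, Multiset.map_add, Multiset.map_singleton, add_right_comm]

theorem transGen_cutExpand_of_le {α : Type*} {r : α → α → Prop} {M N : Multiset α} (h : M ≤ N) :
    M = N ∨ TransGen (CutExpand r) M N := by
  obtain ⟨P, rfl⟩ := Multiset.le_iff_exists_add.1 h
  clear h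
  induction P using Multiset.induction with
  | empty => simp
  | cons a P ih =>
    have hs : CutExpand r (M + P) (M + a ::ₘ P) :=
      ⟨0, a, by simp, by rw [add_zero, ← Multiset.singleton_add, add_comm {a} P, add_assoc]⟩
    rcases ih with ih | ih
    · rw [← ih] at hs
      exact .inr (.single hs)
    · exact .inr (ih.tail hs)

theorem forall_aliens_of_step {P : Term F → Prop} (hsub : ∀ {a b}, Sub a b → P b → P a)
    {t t' p p' : Term F} {K : Multiset (Term F)} (hp : P p') (ht : aliens S F₁ t = K + {p})
    (ht' : aliens S F₁ t' = K + aliens S F₁ p') (h : ∀ a ∈ aliens S F₁ t, P a) :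
    ∀ a ∈ aliens S F₁ t', P a := by
  intro a ha
  rw [ht', Multiset.mem_add] at ha
  rcases ha with ha | ha
  · exact h a (by rw [ht]; exact Multiset.mem_add.2 (.inl ha))
  · exact hsub (sub_of_mem_aliens ha) hp

theorem SN.step {r : Term F → Term F → Prop} {t u : Term F} (h : SN r t) (hu : r t u) : SN r u :=
  h.inv hu

theorem SN.beta {t : Term F} (h : SN (Step E R) t) : SN Beta t :=
  Subrelation.accessible (fun h => .inl h) h

theorem algebraicIn_var_zero : AlgebraicIn S F₁ (var 0) := .var 0

/-! ### Non-duplicating first-order rules -/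

namespace FirstOrderSystem

variable (h : FirstOrderSystem S R E F₁)

include h

theorem sn_equ_aliens {t u : Term F} (hu : Equ E t u)
    (ht : ∀ a ∈ aliens S F₁ t, SN (Step E R) a) : ∀ a ∈ aliens S F₁ u, SN (Step E R) a := by
  induction hu with
  | refl => exact ht
  | tail _ h' ih =>
    intro a ha
    obtain ⟨b, hb, hba⟩ := h.mem_aliens_rew h' ha
    exact h.sn_equ (ih b hb) hba

theorem capLE_equ {t u : Term F} (hu : Equ E t u) :
    CapLE R E F₁ (cap S F₁ (fun _ => var 0) t) (cap S F₁ (fun _ => var 0) u) := by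
  induction hu with
  | refl => exact .refl
  | tail _ h' ih =>
    refine ih.trans (h'.cap h.equation h.equation_algebraic capLE_closed
      (fun _ _ => CapLE.of_equation) fun p p' _ hp hpp' => ?_)
    rw [cap_of_not_fst (h.not_fst_rew hpp' hp)]
    exact .refl

/-- Lexicographic induction on the multiset of alien classes, then on the cap. A cap step keeps a
sub-multiset of the aliens; if none is lost, the cap decreases. -/
theorem sn_of_nonDuplicating (hn : ∀ ρ ∈ headedBy R F₁, NonDuplicating ρ) {t : Term F}
    (ht : ∀ a ∈ aliens S F₁ t, SN (Step E R) a) : SN (Step E R) t := by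
  obtain ⟨M, hM⟩ : ∃ M, (aliens S F₁ t).map (cls E) = M := ⟨_, rfl⟩
  -- The transitive closure is needed because one cap step may erase several aliens.
  induction M using h.wellFounded_clsLT.cutExpand.transGen.induction generalizing t with
  | h M ihM =>
  -- `c` only bounds the cap from above, so that equational steps can be absorbed without changing
  -- it.
  suffices hc : ∀ c, Acc (fun b a => CapLT R E F₁ a b) c → ∀ t,
      (∀ a ∈ aliens S F₁ t, SN (Step E R) a) → (aliens S F₁ t).map (cls E) = M →
      CapLE R E F₁ c (cap S F₁ (fun _ => var 0) t) → SN (Step E R) t from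
    hc _ (h.acc_capLT (cap_algebraic (fun _ => algebraicIn_var_zero) t)) t ht hM .refl
  clear ht hM t
  intro c hc
  induction hc with
  | intro c _ ihc =>
  intro t ht hM hle
  refine ⟨_, fun t' hs => ?_⟩
  rcases hs with hs | ⟨u, hu, hs⟩
  · obtain ⟨p, p', K, -, h2, h3, h4, -⟩ := hs.decompose (S := S) (F₁ := F₁)
    have hp : SN (Step E R) p := ht p (by simp [h3])
    refine ihM _ (.single ?_) (forall_aliens_of_step Sub.sn (hp.step (.inl h2)) h3 h4 ht) rfl
    rw [← hM]
    exact cutExpand_aliens hp (.inl h2) h3 h4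
  · rw [h.map_cls_aliens_equ hu] at hM
    replace ht := h.sn_equ_aliens hu ht
    replace hle := hle.trans (h.capLE_equ hu)
    rcases h.rew_cases hs with ⟨p, p', K, -, h2, h3, h4, -⟩ | ⟨h1, h2, h3⟩
    · have hp : SN (Step E R) p := ht p (by simp [h3])
      have hpp' : Step E R p p' := .inr ⟨p, .refl, h2⟩
      refine ihM _ (.single ?_) (forall_aliens_of_step Sub.sn (hp.step hpp') h3 h4 ht) rfl
      rw [← hM]
      exact cutExpand_aliens hp hpp' h3 h4
    · have ht' : ∀ a ∈ aliens S F₁ t', SN (Step E R) a := fun a ha => ht a (h2 a ha)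
      rcases transGen_cutExpand_of_le (r := ClsLT E R) (Multiset.map_le_map (f := cls E) (h3 hn))
        with h4 | h4
      · exact ihc _ ⟨_, hle, h1 _⟩ t' ht' (h4.trans hM) .refl
      · rw [hM] at h4
        exact ihM _ h4 ht' rfl

end FirstOrderSystem

/-! ### Duplicating first-order rules -/

theorem fst_iff {t : Term F} :
    Fst S F₁ t ↔ ∃ g ∈ F₁, ∃ us, us.length = S.arity g ∧ t = apps (sym g) us := by
  refine exists_congr fun g => and_congr_right fun _ => ⟨Spine.exists_apps, ?_⟩
  rintro ⟨us, h, rfl⟩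
  exact h ▸ spine_apps g us

theorem NotOverApplied.not_fst {t u : Term F} (h : NotOverApplied S F₁ (app t u)) :
    ¬ Fst S F₁ t := fun h' => h.1 (fst_iff.1 h')

theorem NotOverApplied.sub {a t : Term F} (h : Sub a t) (ht : NotOverApplied S F₁ t) :
    NotOverApplied S F₁ a := by
  induction h with
  | refl => exact ht
  | lamL _ _ ih => exact ih ht.1
  | lamR _ _ ih => exact ih ht.2
  | appL _ _ ih => exact ih ht.2.1
  | appR _ _ ih => exact ih ht.2.2
  | prodL _ _ ih => exact ih ht.1
  | prodR _ _ ih => exact ih ht.2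

variable (S R E F₁) in
/-- No reduct of the term contains an over-applied first-order symbol. -/
def NeverOverApplied (t : Term F) : Prop := ∀ u, Reduces E R t u → NotOverApplied S F₁ u

theorem NeverOverApplied.reduces {t u : Term F} (h : NeverOverApplied S R E F₁ t)
    (hu : Reduces E R t u) : NeverOverApplied S R E F₁ u := fun v hv => h v (hu.trans hv)

theorem NeverOverApplied.sub {a t : Term F} (h : Sub a t) (ht : NeverOverApplied S R E F₁ t) :
    NeverOverApplied S R E F₁ a := by
  intro u hu
  obtain ⟨C, rfl, h2, h3⟩ := h.exists_context
  have hc : CtxClosed (Reduces E R) :=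
    (beta_closed.or ((rew_closed R).or (rew_closed E))).star
  exact NotOverApplied.sub (h2 u) (ht _ (h3 _ hc _ _ hu))

theorem reduces_beta {t u : Term F} (h : ReflTransGen Beta t u) : Reduces E R t u :=
  star_map (g := id) (fun _ _ h => .inl h) h

theorem reduces_rew {t u : Term F} (h : Rew (R ∪ E) t u) : Reduces E R t u :=
  .single (.inr h.of_union)

/-- Used contrapositively: if an instance of a left-hand side is `β`-normal, so is the substitution
on its variables. -/
theorem Pat.exists_beta {b : Bool} {l : Term F} (h : Pat b l) {σ : ℕ → Term F} {x : ℕ}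
    {s : Term F} (hs : Beta (σ x) s) (hx : occ x l ≠ 0) : ∃ v, Beta (subst σ l) v := by
  induction h with
  | var n =>
    obtain rfl : n = x := by by_contra hne; simp [occ, hne] at hx
    exact ⟨s, hs⟩
  | sym _ f => simp [occ] at hx
  | @app _ l₁ l₂ _ _ ih1 ih2 =>
    simp only [occ] at hx
    by_cases h0 : occ x l₁ = 0
    · obtain ⟨v, hv⟩ := ih2 (by omega)
      exact ⟨_, .appR _ hv⟩
    · obtain ⟨v, hv⟩ := ih1 h0
      exact ⟨_, .appL _ hv⟩

theorem Spine.beta {g : F} {k : ℕ} {t t' : Term F} (h : Spine g k t) (ht : Beta t t') :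
    Spine g k t' := by
  induction h generalizing t' with
  | sym =>
    cases ht with
    | root h => obtain ⟨_, _, _, h, _⟩ := h; cases h
  | app u h ih =>
    cases ht with
    | root h' =>
      obtain ⟨_, _, _, h', _⟩ := h'
      cases h'
      cases h
    | appL _ h' => exact .app _ (ih h')
    | appR _ h' => exact .app _ h

theorem Spine.beta_app {g : F} {k : ℕ} {t u n : Term F} (h : Spine g k t)
    (hn : ReflTransGen Beta (Term.app t u) n) : ∃ t' u', n = Term.app t' u' ∧
      ReflTransGen Beta t t' ∧ ReflTransGen Beta u u' ∧ Spine g k t' := by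
  induction hn with
  | refl => exact ⟨t, u, rfl, .refl, .refl, h⟩
  | tail _ hs ih =>
    obtain ⟨t', u', rfl, h1, h2, h3⟩ := ih
    cases hs with
    | root h' =>
      obtain ⟨_, _, _, h', _⟩ := h'
      cases h'
      cases h3
    | appL _ h' => exact ⟨_, _, rfl, h1.tail h', h2, h3.beta h'⟩
    | appR _ h' => exact ⟨_, _, rfl, h1, h2.tail h', h3⟩

open Classical in
/-- A `β`-normal form of a term, if there is one. -/
noncomputable def betaNF (t : Term F) : Term F :=
  if h : ∃ n, ReflTransGen Beta t n ∧ BetaNormal n then h.choose else t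

theorem betaNF_spec {t : Term F} (h : SN Beta t) :
    ReflTransGen Beta t (betaNF t) ∧ BetaNormal (betaNF t) := by
  rw [betaNF, dif_pos (exists_betaNormal h)]
  exact (exists_betaNormal h).choose_spec

theorem betaNF_eq {t n : Term F} (h : SN Beta t) (hn : ReflTransGen Beta t n)
    (hn' : BetaNormal n) : betaNF t = n :=
  (hn'.eq (beta_confluent h (betaNF_spec h).1 (betaNF_spec h).2 hn)).symm ▸ rfl

variable (S F₁) in
/-- The cap of the `β`-normal form of a term. -/
noncomputable def nfCap (t : Term F) : Term F := cap S F₁ (fun _ => var 0) (betaNF t)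

theorem Sub.sn_beta {a s : Term F} (h : Sub a s) (hs : SN Beta s) : SN Beta a := by
  obtain ⟨C, rfl, -, h3⟩ := h.exists_context
  exact Subrelation.accessible (fun hbc => h3 _ beta_closed _ _ hbc) (InvImage.accessible C hs)

/-- Normalizing the aliens of a term normalizes the whole term. -/
theorem cap_nfCap {t n : Term F} (ht : SN Beta t) (hn : ReflTransGen Beta t n)
    (hn' : BetaNormal n) : cap S F₁ (nfCap S F₁) t = cap S F₁ (fun _ => var 0) n := by
  -- `β` never touches a head symbol, so spines survive. The normal form of an alien may be headed
  -- by a first-order symbol; its cap then merges with the surrounding one.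
  suffices hw : ∀ t n, SN Beta t → ReflTransGen Beta t n → BetaNormal n → ∀ g k, Spine g k t →
      Spine g k n ∧ scap S F₁ (nfCap S F₁) t = scap S F₁ (fun _ => var 0) n by
    by_cases hf : Fst S F₁ t
    · obtain ⟨g, hg, hs⟩ := id hf
      obtain ⟨h1, h2⟩ := hw t n ht hn hn' g _ hs
      rw [hf.cap, Fst.cap ⟨g, hg, h1⟩, h2]
    · rw [cap_of_not_fst hf, nfCap, betaNF_eq ht hn hn']
  clear ht hn hn' t n
  intro t
  induction t with
  | sym f =>
    intro n _ hn hn' g k hs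
    cases hs
    have : BetaNormal (sym f) := by
      intro u hu
      cases hu with
      | root h => obtain ⟨_, _, _, h, _⟩ := h; cases h
    rw [this.eq hn]
    exact ⟨.sym, rfl⟩
  | app t u iht ihu =>
    intro n ht hn hn' g k hs
    cases hs with
    | app _ hs =>
      obtain ⟨t', u', rfl, h1, h2, -⟩ := hs.beta_app hn
      obtain ⟨h4, h5⟩ := iht t' ((Sub.appL _ .refl).sn_beta ht) h1
        (fun v hv => hn' _ (.appL _ hv)) g _ hs
      refine ⟨.app _ h4, ?_⟩
      rw [scap_app, scap_app, h5]
      congr 1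
      have hu : SN Beta u := (Sub.appR _ .refl).sn_beta ht
      have hu' : BetaNormal u' := fun v hv => hn' _ (.appR _ hv)
      by_cases hf : Fst S F₁ u
      · obtain ⟨g, hg, hs⟩ := id hf
        obtain ⟨h1, h2⟩ := ihu u' hu h2 hu' g _ hs
        rw [hf.cap, Fst.cap ⟨g, hg, h1⟩, h2]
      · rw [cap_of_not_fst hf, nfCap, betaNF_eq hu h2 hu']
  | _ => intro n _ _ _ g k h; cases h

theorem cap_nfCap_self {t : Term F} (ht : SN Beta t) :
    cap S F₁ (nfCap S F₁) t = nfCap S F₁ t :=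
  cap_nfCap ht (betaNF_spec ht).1 (betaNF_spec ht).2

theorem nfCap_beta {t u : Term F} (ht : SN Beta t) (h : Beta t u) :
    nfCap S F₁ t = nfCap S F₁ u := by
  have hu : SN Beta u := ht.step h
  rw [nfCap, betaNF_eq ht (.head h (betaNF_spec hu).1) (betaNF_spec hu).2, nfCap]

namespace FirstOrderSystem

variable (h : FirstOrderSystem S R E F₁) (hR₁ : R ⊆ headedBy R F₁)

include h

theorem union_pat : ∀ ρ ∈ R ∪ E, Pat false ρ.lhs := by
  rintro ρ (hρ | hρ)
  · exact (h.rule ρ hρ).pat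
  · exact (h.equation ρ hρ).pat

include hR₁

theorem fst_of_rewRoot {t t' : Term F} (ht : RewRoot R t t') : Fst S F₁ t := by
  obtain ⟨ρ, hρ, σ, rfl, rfl⟩ := ht
  exact (h.rule_algebraic ρ (hR₁ hρ)).1.fst_subst (h.rule ρ hρ).not_var σ

theorem eq_lam_of_rew {t A b : Term F} (ht : Rew (R ∪ E) t (lam A b)) (hf : ¬ Fst S F₁ t) :
    ∃ A' b', t = lam A' b' := by
  generalize hu : lam A b = u at ht
  cases ht with
  | root h' =>
    obtain ⟨ρ, hρ | hρ, σ, rfl, rfl⟩ := h'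
    · exact (hf (h.fst_of_rewRoot hR₁ ⟨ρ, hρ, σ, rfl, rfl⟩)).elim
    · exact ((h.equation _ (h.swap_mem hρ)).pat.subst_ne_lam _ _ _ hu.symm).elim
  | lamL => exact ⟨_, _, rfl⟩
  | lamR => exact ⟨_, _, rfl⟩
  | _ => cases hu

/-- A new `β`-redex would need an abstraction to appear in function position. Only a collapsing
first-order rule could produce it, and its redex would be an over-applied symbol. -/
theorem betaNormal_rew {n n' : Term F} (hr : Rew (R ∪ E) n n') (hn : BetaNormal n)
    (ho : NotOverApplied S F₁ n) : BetaNormal n' := by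
  induction hr with
  | root hr =>
    obtain ⟨ρ, hρ, σ, rfl, rfl⟩ := hr
    intro v hv
    have hr : Pat true ρ.rhs ∧ FV ρ.rhs ⊆ FV ρ.lhs := by
      rcases hρ with hρ | hρ
      · exact ⟨(h.rule_algebraic ρ (hR₁ hρ)).2.pat, (h.rule ρ hρ).fv_subset⟩
      · exact ⟨(h.equation _ (h.swap_mem hρ)).pat.toTrue, (h.equation ρ hρ).fv_subset⟩
    obtain ⟨x, s, h1, h2, -, -⟩ := hr.1.beta_subst hv
    obtain ⟨w, hw⟩ := (h.union_pat ρ hρ).exists_beta h2 (hr.2 h1)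
    exact hn w hw
  | lamL t hr ih =>
    intro v hv
    cases hv with
    | root h' => obtain ⟨_, _, _, h', _⟩ := h'; cases h'
    | lamL _ hv => exact ih (fun w hw => hn _ (.lamL _ hw)) ho.1 _ hv
    | lamR _ hv => exact hn _ (.lamR _ hv)
  | lamR t hr ih =>
    intro v hv
    cases hv with
    | root h' => obtain ⟨_, _, _, h', _⟩ := h'; cases h'
    | lamR _ hv => exact ih (fun w hw => hn _ (.lamR _ hw)) ho.2 _ hv
    | lamL _ hv => exact hn _ (.lamL _ hv)
  | prodL t hr ih =>
    intro v hv
    cases hv with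
    | root h' => obtain ⟨_, _, _, h', _⟩ := h'; cases h'
    | prodL _ hv => exact ih (fun w hw => hn _ (.prodL _ hw)) ho.1 _ hv
    | prodR _ hv => exact hn _ (.prodR _ hv)
  | prodR t hr ih =>
    intro v hv
    cases hv with
    | root h' => obtain ⟨_, _, _, h', _⟩ := h'; cases h'
    | prodR _ hv => exact ih (fun w hw => hn _ (.prodR _ hw)) ho.2 _ hv
    | prodL _ hv => exact hn _ (.prodL _ hv)
  | appL u hr ih =>
    intro v hv
    cases hv with
    | root h' =>
      obtain ⟨A, b, _, h', _⟩ := h'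
      simp only [app.injEq] at h'
      obtain ⟨rfl, rfl⟩ := h'
      obtain ⟨A', b', rfl⟩ := h.eq_lam_of_rew hR₁ hr ho.not_fst
      exact hn _ (.root ⟨_, _, _, rfl, rfl⟩)
    | appL _ hv => exact ih (fun w hw => hn _ (.appL _ hw)) ho.2.1 _ hv
    | appR _ hv => exact hn _ (.appR _ hv)
  | appR t hr ih =>
    intro v hv
    cases hv with
    | root h' =>
      obtain ⟨A, b, _, h', _⟩ := h'
      simp only [app.injEq] at h'
      obtain ⟨rfl, rfl⟩ := h'
      exact hn _ (.root ⟨_, _, _, rfl, rfl⟩)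
    | appR _ hv => exact ih (fun w hw => hn _ (.appR _ hw)) ho.2.2 _ hv
    | appL _ hv => exact hn _ (.appL _ hv)

/-- All rules are first-order, so the head could change only by contracting a fully applied symbol
at the root or in function position; both are excluded. -/
theorem spine_of_rew {t t' : Term F} {g : F} {k : ℕ} (ht : Rew R t t') (hf : ¬ Fst S F₁ t)
    (ho : NotOverApplied S F₁ t) (hs : Spine g k t') : Spine g k t := by
  induction ht generalizing k with
  | root h' => exact (hf (h.fst_of_rewRoot hR₁ h')).elim
  | appL u _ ih =>
    cases hs with
    | app _ hs => exact .app _ (ih ho.not_fst ho.2.1 hs)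
  | appR t _ _ =>
    cases hs with
    | app _ hs => exact .app _ hs
  | _ => cases hs

theorem not_fst_rew_union {t t' : Term F} (ht : Rew (R ∪ E) t t') (hf : ¬ Fst S F₁ t)
    (ho : NotOverApplied S F₁ t) : ¬ Fst S F₁ t' := by
  rcases ht.of_union with ht | ht
  · rintro ⟨g, hg, hs⟩
    exact hf ⟨g, hg, h.spine_of_rew hR₁ ht hf ho hs⟩
  · exact h.not_fst_rew ht hf

/-- Aliens stay aliens here, so a constant value for them is preserved and only cap steps are
visible. -/
theorem capLE_rew_star {n n' : Term F} (hn : NeverOverApplied S R E F₁ n)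
    (hr : ReflTransGen (Rew (R ∪ E)) n n') :
    CapLE R E F₁ (cap S F₁ (fun _ => var 0) n) (cap S F₁ (fun _ => var 0) n') := by
  suffices hw : NeverOverApplied S R E F₁ n' ∧
      CapLE R E F₁ (cap S F₁ (fun _ => var 0) n) (cap S F₁ (fun _ => var 0) n') from hw.2
  induction hr with
  | refl => exact ⟨hn, .refl⟩
  | tail _ h' ih =>
    refine ⟨ih.1.reduces (reduces_rew h'), ih.2.trans (h'.cap (S := S) ?_ ?_ capLE_closed
      (fun _ _ => ReflTransGen.single) fun p p' hp hpf hpp' => ?_)⟩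
    · rintro ρ (hρ | hρ)
      exacts [h.rule ρ hρ, h.equation ρ hρ]
    · rw [headedBy_union]
      rintro ρ (hρ | hρ)
      exacts [h.rule_algebraic ρ hρ, h.equation_algebraic ρ hρ]
    · rw [cap_of_not_fst (h.not_fst_rew_union hR₁ hpp' hpf
        (NotOverApplied.sub (sub_of_mem_aliens hp) (ih.1 _ .refl)))]
      exact .refl

/-- The `β`-normal form of a rewrite of `u` is obtained by rewriting that of `u`. -/
theorem exists_betaNormal_rew {u : Term F} (hu : SN (Step E R) u)
    (ho : NeverOverApplied S R E F₁ u) {u' n : Term F} (hr : Rew (R ∪ E) u u')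
    (hn : ReflTransGen Beta u n) (hn' : BetaNormal n) :
    ∃ n', ReflTransGen Beta u' n' ∧ BetaNormal n' ∧ ReflTransGen (Rew (R ∪ E)) n n' := by
  have hacc := h.acc_down hu
  induction hacc generalizing u' n with
  | intro u _ ih =>
  rcases ReflTransGen.cases_head hn with rfl | ⟨v, huv, hvn⟩
  · exact ⟨u', .refl, h.betaNormal_rew hR₁ hr hn' (ho _ .refl), .single hr⟩
  -- `a` is a proper `β`-reduct of `u` that still normalizes to `n`. Every term on the rewriting
  -- path from `a` to `b` lies below `u` for `Down`, so the induction hypothesis transports the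
  -- normal form along it.
  obtain ⟨a, h1, b, h2, h3⟩ := rew_beta_join h.union_pat hr huv
  have hda : Down E R u a :=
    ⟨a, TransGen.head' (.inl huv) (star_map (g := id) (fun _ _ hs => .inl hs) h1), .refl⟩
  have hna : ReflTransGen Beta a n := beta_confluent (hu.beta.step huv) hvn hn' h1
  have hoa : NeverOverApplied S R E F₁ a := ho.reduces (reduces_beta (.head huv h1))
  have key : ∀ {b}, ReflTransGen (Rew (R ∪ E)) a b → Down E R u b ∧
      NeverOverApplied S R E F₁ b ∧
      ∃ n', ReflTransGen Beta b n' ∧ BetaNormal n' ∧ ReflTransGen (Rew (R ∪ E)) n n' := by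
    intro b hb
    induction hb with
    | refl => exact ⟨hda, hoa, n, hna, hn', .refl⟩
    | @tail b c _ hbc ihb =>
      obtain ⟨hd, hob, m, hm1, hm2, hm3⟩ := ihb
      obtain ⟨m', h4, h5, h6⟩ := ih b hd (h.sn_down hu hd) hob hbc hm1 hm2
      refine ⟨?_, hob.reduces (reduces_rew hbc), m', h4, h5, hm3.trans h6⟩
      rcases hbc.of_union with hbc | hbc
      · exact h.down_trans hd (Step.down (.inr ⟨b, .refl, hbc⟩))
      · exact hd.equ (.single hbc)
  obtain ⟨-, -, n', h4, h5, h6⟩ := key h2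
  exact ⟨n', h3.trans h4, h5, h6⟩

theorem capLE_nfCap {p p' : Term F} (hp : SN (Step E R) p) (ho : NeverOverApplied S R E F₁ p)
    (hr : Rew (R ∪ E) p p') : CapLE R E F₁ (nfCap S F₁ p) (cap S F₁ (nfCap S F₁) p') := by
  obtain ⟨h1, h2⟩ := betaNF_spec hp.beta
  obtain ⟨n', h3, h4, h5⟩ := h.exists_betaNormal_rew hR₁ hp ho hr h1 h2
  have hp' : SN (Step E R) p' := by
    rcases hr.of_union with hr | hr
    · exact hp.step (.inr ⟨p, .refl, hr⟩)
    · exact h.sn_equ hp (.single hr)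
  rw [cap_nfCap hp'.beta h3 h4]
  exact h.capLE_rew_star hR₁ (ho.reduces (reduces_beta h1)) h5

theorem capLE_nfCap_equ {t u : Term F} (hu : Equ E t u)
    (ht : ∀ a ∈ aliens S F₁ t, SN (Step E R) a ∧ NeverOverApplied S R E F₁ a) :
    (∀ a ∈ aliens S F₁ u, SN (Step E R) a ∧ NeverOverApplied S R E F₁ a) ∧
    CapLE R E F₁ (cap S F₁ (nfCap S F₁) t) (cap S F₁ (nfCap S F₁) u) := by
  induction hu with
  | refl => exact ⟨ht, .refl⟩
  | tail _ h' ih =>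
    refine ⟨fun a ha => ?_, ih.2.trans (h'.cap h.equation h.equation_algebraic capLE_closed
      (fun _ _ => CapLE.of_equation) fun p p' hp hpf hpp' => ?_)⟩
    · obtain ⟨b, hb, hba⟩ := h.mem_aliens_rew h' ha
      obtain ⟨h1, h2⟩ := ih.1 b hb
      exact ⟨h.sn_equ h1 hba, h2.reduces (star_map (g := id) (fun _ _ h => .inr (.inr h)) hba)⟩
    · obtain ⟨h1, h2⟩ := ih.1 p hp
      exact h.capLE_nfCap hR₁ h1 h2 (hpp'.mono Set.subset_union_right)

/-- Lexicographic induction with the cap first: a cap step may copy aliens but decreases the cap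
strictly, while a step in an alien does so weakly and decreases the multiset. -/
theorem sn_of_neverOverApplied {t : Term F}
    (ht : ∀ a ∈ aliens S F₁ t, SN (Step E R) a ∧ NeverOverApplied S R E F₁ a) :
    SN (Step E R) t := by
  have hsub : ∀ {a b : Term F}, Sub a b → SN (Step E R) b ∧ NeverOverApplied S R E F₁ b →
      SN (Step E R) a ∧ NeverOverApplied S R E F₁ a := fun h h' => ⟨h.sn h'.1, .sub h h'.2⟩
  suffices hc : ∀ c, Acc (fun b a => CapLT R E F₁ a b) c → ∀ t,
      (∀ a ∈ aliens S F₁ t, SN (Step E R) a ∧ NeverOverApplied S R E F₁ a) →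
      CapLE R E F₁ c (cap S F₁ (nfCap S F₁) t) → SN (Step E R) t from
    hc _ (h.acc_capLT (cap_algebraic
      (fun a => cap_algebraic (fun _ => algebraicIn_var_zero) (betaNF a)) t)) t ht .refl
  clear ht t
  intro c hc
  induction hc with
  | intro c _ ihc =>
  intro t ht hle
  obtain ⟨M, hM⟩ : ∃ M, (aliens S F₁ t).map (cls E) = M := ⟨_, rfl⟩
  -- With `c` fixed, the cap moves only along `CapLE` and remains bounded by `c`.
  induction M using h.wellFounded_clsLT.cutExpand.induction generalizing t with
  | h M ihM =>
  refine ⟨_, fun t' hs => ?_⟩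
  rcases hs with hs | ⟨u, hu, hs⟩
  · obtain ⟨p, p', K, -, h2, h3, h4, h5⟩ := hs.decompose (S := S) (F₁ := F₁)
    obtain ⟨hp, hop⟩ := ht p (by simp [h3])
    have hp' : SN (Step E R) p' := hp.step (.inl h2)
    refine ihM _ ?_ t' (forall_aliens_of_step hsub
      ⟨hp', hop.reduces (reduces_beta (.single h2))⟩ h3 h4 ht) (hle.trans ?_) rfl
    · rw [← hM]
      exact cutExpand_aliens hp (.inl h2) h3 h4
    · refine h5 _ _ capLE_closed ?_
      rw [cap_nfCap_self hp'.beta, nfCap_beta hp.beta h2]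
  · rw [h.map_cls_aliens_equ hu] at hM
    obtain ⟨ht, hle'⟩ := h.capLE_nfCap_equ hR₁ hu ht
    replace hle := hle.trans hle'
    rcases h.rew_cases hs with ⟨p, p', K, -, h2, h3, h4, h5⟩ | ⟨h1, h2, -⟩
    · obtain ⟨hp, hop⟩ := ht p (by simp [h3])
      have hpp' : Step E R p p' := .inr ⟨p, .refl, h2⟩
      have hr : Rew (R ∪ E) p p' := h2.mono Set.subset_union_left
      refine ihM _ ?_ t' (forall_aliens_of_step hsub
        ⟨hp.step hpp', hop.reduces (reduces_rew hr)⟩ h3 h4 ht) (hle.trans ?_) rfl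
      · rw [← hM]
        exact cutExpand_aliens hp hpp' h3 h4
      · exact h5 _ _ capLE_closed (h.capLE_nfCap hR₁ hp hop hr)
    · exact ihc _ ⟨_, hle, h1 _⟩ t' (fun a ha => ht a (h2 a ha)) .refl

end FirstOrderSystem

/-! ### Partial applications -/

theorem Spine.rew {X : Set (Rule F)} (hX : ∀ ρ ∈ X, IsRule S ρ) {g : F} {k : ℕ} {t t' : Term F}
    (h : Spine g k t) (hk : k < S.arity g) (ht : Rew X t t') : Spine g k t' := by
  induction ht generalizing k with
  | root h' =>
    have := (rewRoot_spine (F₁ := Set.univ) hX (Set.mem_univ g) h' h).1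
    omega
  | appL u _ ih =>
    cases h with
    | app _ h => exact .app _ (ih h (by omega))
  | appR _ _ _ =>
    cases h with
    | app _ h => exact .app _ h
  | _ => cases h

theorem Spine.rew_app {X : Set (Rule F)} (hX : ∀ ρ ∈ X, IsRule S ρ) {g : F} {k : ℕ}
    {t u w : Term F} (h : Spine g k t) (hk : k + 1 < S.arity g) (hw : Rew X (Term.app t u) w) :
    (∃ t', w = Term.app t' u ∧ Rew X t t' ∧ Spine g k t') ∨
      ∃ u', w = Term.app t u' ∧ Rew X u u' := by
  cases hw with
  | root h' =>
    have := (rewRoot_spine (F₁ := Set.univ) hX (Set.mem_univ g) h' (h.app u)).1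
    omega
  | appL _ h' => exact .inl ⟨_, rfl, h', h.rew hX (by omega) h'⟩
  | appR _ h' => exact .inr ⟨_, rfl, h'⟩

namespace FirstOrderSystem

variable (h : FirstOrderSystem S R E F₁)

include h

theorem sn_sym {f : F} (hf : S.arity f ≠ 0) : SN (Step E R) (sym f) := by
  have hX : ∀ {X : Set (Rule F)} (hX : ∀ ρ ∈ X, IsRule S ρ) {w}, ¬ Rew X (sym f) w := by
    intro X hX w hw
    cases hw with
    | root h' => exact hf (rewRoot_spine (F₁ := Set.univ) hX (Set.mem_univ f) h' .sym).1.symm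
  refine ⟨_, fun w hw => ?_⟩
  rcases hw with hw | ⟨u, hu, hw⟩
  · cases hw with
    | root h' => obtain ⟨_, _, _, h', _⟩ := h'; cases h'
  · rcases ReflTransGen.cases_head hu with rfl | ⟨_, hu, _⟩
    · exact (hX h.rule hw).elim
    · exact (hX h.equation hu).elim

theorem spine_equ_app {g : F} {k : ℕ} {t u w : Term F} (hs : Spine g k t)
    (hk : k + 1 < S.arity g) (hw : Equ E (app t u) w) :
    ∃ t' u', w = app t' u' ∧ Equ E t t' ∧ Equ E u u' ∧ Spine g k t' := by
  induction hw with
  | refl => exact ⟨t, u, rfl, .refl, .refl, hs⟩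
  | tail _ h' ih =>
    obtain ⟨t', u', rfl, h1, h2, h3⟩ := ih
    rcases h3.rew_app h.equation hk h' with ⟨t'', rfl, h4, h5⟩ | ⟨u'', rfl, h4⟩
    · exact ⟨_, _, rfl, h1.tail h4, h2, h5⟩
    · exact ⟨_, _, rfl, h1, h2.tail h4, h3⟩

/-- Below the arity nothing happens at the root, so the two components reduce independently. The
nested induction works up to equivalence, because a step modulo may first apply equations in both.
-/
theorem sn_app_of_spine {g : F} {k : ℕ} {t u : Term F} (hs : Spine g k t)
    (hk : k + 1 < S.arity g) (ht : SN (Step E R) t) (hu : SN (Step E R) u) :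
    SN (Step E R) (app t u) := by
  suffices hw : ∀ t, Acc (fun b a => Down E R a b) t → ∀ u, Acc (fun b a => Down E R a b) u →
      ∀ t' u', Equ E t t' → Equ E u u' → Spine g k t' → SN (Step E R) (app t' u') from
    hw t (h.acc_down ht) u (h.acc_down hu) t u .refl .refl hs
  clear hs ht hu t u
  intro t ht
  induction ht with
  | intro t _ iht =>
  intro u hu
  -- When `t` steps, the outer hypothesis needs the accessibility of `u` itself.
  have hu₀ := hu
  induction hu with
  | intro u _ ihu =>
  intro t' u' h1 h2 hs
  refine ⟨_, fun w hw => ?_⟩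
  have hL : ∀ {x y : Term F}, Equ E t x → Step E R x y → ∀ v, Equ E u v → Spine g k y →
      SN (Step E R) (app y v) := fun hx hxy v hv hy =>
    iht _ (h.equ_down hx hxy.down) u hu₀ _ v .refl hv hy
  have hR : ∀ {x y : Term F}, Equ E u x → Step E R x y → ∀ s, Equ E t s → Spine g k s →
      SN (Step E R) (app s y) := fun hx hxy s hs hs' =>
    ihu _ (h.equ_down hx hxy.down) (hu₀.inv (h.equ_down hx hxy.down)) s _ hs .refl hs'
  rcases hw with hw | ⟨v, hv, hw⟩
  · cases hw with
    | root h' =>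
      obtain ⟨_, _, _, h', _⟩ := h'
      cases h'
      cases hs
    | appL _ h' => exact hL h1 (.inl h') _ h2 (hs.beta h')
    | appR _ h' => exact hR h2 (.inl h') _ h1 hs
  · obtain ⟨x, y, rfl, h3, h4, h5⟩ := h.spine_equ_app hs hk hv
    rcases h5.rew_app h.rule hk hw with ⟨x', rfl, h6, h7⟩ | ⟨y', rfl, h6⟩
    · exact hL (h1.trans h3) (.inr ⟨x, .refl, h6⟩) _ (h2.trans h4) h7
    · exact hR (h2.trans h4) (.inr ⟨y, .refl, h6⟩) _ (h1.trans h3) h5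

theorem sn_partial {f : F} {ts : List (Term F)} (hl : ts.length < S.arity f)
    (hts : ∀ t ∈ ts, SN (Step E R) t) : SN (Step E R) (apps (sym f) ts) := by
  induction ts using List.reverseRecOn with
  | nil => exact h.sn_sym (Nat.ne_of_gt hl)
  | append_singleton ts t ih =>
    rw [List.length_append, List.length_singleton] at hl
    rw [apps_concat]
    exact h.sn_app_of_spine (spine_apps f ts) hl (ih (by omega) fun u hu => hts u (by simp [hu]))
      (hts t (by simp))

theorem sn_apps (hdup : (headedBy R F₁ᶜ).Nonempty → ∀ ρ ∈ headedBy R F₁, NonDuplicating ρ)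
    {f : F} (hf : f ∈ F₁) {ts : List (Term F)} (hl : ts.length ≤ S.arity f)
    (hts : ∀ t ∈ ts, SN (Step E R) t)
    (hover : (∃ ρ ∈ headedBy R F₁, ¬ NonDuplicating ρ) →
      ∀ t ∈ ts, NeverOverApplied S R E F₁ t) : SN (Step E R) (apps (sym f) ts) := by
  rcases hl.lt_or_eq with hl | hl
  · exact h.sn_partial hl hts
  have hfst : Fst S F₁ (apps (sym f) ts) := ⟨f, hf, hl ▸ spine_apps f ts⟩
  have hmem : ∀ a ∈ aliens S F₁ (apps (sym f) ts), ∃ t ∈ ts, Sub a t := by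
    rw [hfst.aliens]
    exact fun a => exists_mem_of_mem_saliens_apps f
  by_cases hn : ∀ ρ ∈ headedBy R F₁, NonDuplicating ρ
  · refine h.sn_of_nonDuplicating hn fun a ha => ?_
    obtain ⟨t, ht, hs⟩ := hmem a ha
    exact hs.sn (hts t ht)
  -- A rule headed outside `F₁` would force all first-order rules to be non-duplicating.
  · have hR₁ : R ⊆ headedBy R F₁ := by
      intro ρ hρ
      by_contra hρ₁
      refine hn (hdup ⟨ρ, hρ, ?_⟩)
      -- The identity substitution `var` serves only to extract the head symbol of the left-hand
      -- side.
      obtain ⟨g, -, hg⟩ := (h.rule ρ hρ).algebraic.fst_subst (h.rule ρ hρ).not_var var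
      obtain ⟨-, us, hus⟩ := (h.rule ρ hρ).spine hg
      exact ⟨g, fun hg => hρ₁ ⟨hρ, g, hg, us, hus⟩, us, hus⟩
    refine h.sn_of_neverOverApplied hR₁ fun a ha => ?_
    obtain ⟨t, ht, hs⟩ := hmem a ha
    exact ⟨hs.sn (hts t ht), .sub hs (hover (by simpa using hn) t ht)⟩

end FirstOrderSystem

end

end CAC

theorem mainTheorem2 {F : Type*} (S : CAC.Signature F) (R E : Set (CAC.Rule F)) (F₁ : Set F)
    (hF₁ : ∀ f ∈ F₁, CAC.IsFirstOrder S R f)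
    (hR : ∀ ρ ∈ R, CAC.IsRule S ρ)
    (hE : ∀ ρ ∈ E, CAC.IsRule S ρ)
    (hE_symm : ∀ l r, (⟨l, r⟩ : CAC.Rule F) ∈ E ↔ (⟨r, l⟩ : CAC.Rule F) ∈ E)
    (hR₁ : ∀ ρ ∈ CAC.headedBy R F₁, CAC.AlgebraicIn S F₁ ρ.lhs ∧ CAC.AlgebraicIn S F₁ ρ.rhs)
    (hE₁ : ∀ ρ ∈ CAC.headedBy E F₁, CAC.AlgebraicIn S F₁ ρ.lhs ∧ CAC.AlgebraicIn S F₁ ρ.rhs)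
    (hSN₁ : ∀ t, CAC.AlgebraicIn S F₁ t →
      CAC.SN (CAC.RewMod (CAC.headedBy E F₁) (CAC.headedBy R F₁)) t)
    (hdup : (CAC.headedBy R F₁ᶜ).Nonempty → ∀ ρ ∈ CAC.headedBy R F₁, CAC.NonDuplicating ρ)
    (hlin : ∀ ρ ∈ E, CAC.Term.Linear ρ.lhs ∧ CAC.Term.Linear ρ.rhs)
    (hfin : ∀ t, {u | CAC.Equ E t u}.Finite)
    (f : F) (hf : f ∈ F₁) (ts : List (CAC.Term F)) (hlen : ts.length ≤ S.arity f)
    (hts : ∀ t ∈ ts, CAC.SN (CAC.Step E R) t)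
    (hover : (∃ ρ ∈ CAC.headedBy R F₁, ¬ CAC.NonDuplicating ρ) →
      ∀ t ∈ ts, ∀ u, CAC.Reduces E R t u → CAC.NotOverApplied S F₁ u) :
    CAC.SN (CAC.Step E R) (CAC.Term.apps (CAC.Term.sym f) ts) := by
  exact CAC.FirstOrderSystem.sn_apps ⟨hR, hE, hE_symm, hR₁, hE₁, hSN₁, hlin⟩ hdup hf hlen hts hover
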